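/- A finite discounted Markov decision process (MDP) is a tuple $M=(S,A,p,r,\gamma)$ with finite sets $S$ of states and $A$ of actions, transition probabilities $p_{s,a}^{s'}$, a reward function $r:S\to[0,1]$ and a discount rate $\gamma\in(0,1)$. A (possibly non-stationary) policy is a function $\pi:S^*\to A$, where $S^*$ is the set of finite sequences of states. Following $\pi$ in $M$ from a start state $s_1$ produces a random sequence $s_1,s_2,\dots$ with $s_{t+1}\sim p_{s_t,\pi(s_1,\dots,s_t)}$. Write $V^\pi(s_1,\dots,s_t)=\mathbf E\big[\sum_{k\ge 0}\gamma^k r(s_{t+k})\,\big|\,s_1,\dots,s_t\big]$ for the value of $\pi$ after the history $s_1,\dots,s_t$, and $V^*(s)$ for the maximum over all stationary policies of the value in state $s$. Theorem. There are universal constants $c_1,c_2,\varepsilon_0>0$ such that the following holds for all finite sets $S$, $A$ with $|S|\ge 4$, $|A|\ge 2$ and all real $\gamma,\varepsilon,\delta$ with $\tfrac34<\gamma<1$, $0<\varepsilon<\varepsilon_0/(1-\gamma)$ and $0<\delta<1$. There are a reward function $r:S\to[0,1]$, a start state $s_1\in S$ and, for every $(s,a)\in S\times A$, two states $sa^+,sa^-\in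 S$ such that for every policy $\pi$ (which may therefore depend on $S,A,r,\gamma,\varepsilon,\delta$, as well as on $s_1$ and the states $sa^\pm$) there is an MDP $M_{\mathrm{hard}}=(S,A,p,r,\gamma)$ with $p_{s,a}^{s'}=0$ for all $(s,a)$ and all $s'\notin\{sa^+,sa^-\}$, in which, when $\pi$ is followed from $s_1$, with probability at least $\delta$ one has $$V^*(s_t)-V^\pi(s_1,\dots,s_t)>\varepsilon\quad\text{for at least}\quad N:=\frac{c_1\,|S\times A|}{\varepsilon^2(1-\gamma)^3}\log\frac{c_2}{\delta}\quad\text{time-steps } t.$$ -/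

import Mathlib

open MeasureTheory ProbabilityTheory

/-- A finite discounted Markov decision process with states `S` and actions `A`: transition
probabilities `trans s a : PMF S`, a state reward with values in `[0, 1]` and a discount rate in
`(0, 1)`. -/
structure MDP (S A : Type*) where
  trans : S → A → PMF S
  reward : S → ℝ
  reward_mem : ∀ s, reward s ∈ Set.Icc (0 : ℝ) 1
  discount : ℝ
  discount_mem : discount ∈ Set.Ioo (0 : ℝ) 1

/-- A (possibly non-stationary) policy chooses an action from the finite sequence of the states seen
so far, the current state being the last entry. -/
abbrev Policy (S A : Type*) := List S → A

/-- The states seen strictly before time `t` along the trajectory `ω`. -/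
def pastStates {S : Type*} (ω : ℕ → S) (t : ℕ) : List S := List.ofFn fun i : Fin t => ω i

namespace MDP

variable {S A : Type*}

/-- Every state/action pair `(s, a)` has at most the two possible next states `sp s a` and
`sm s a`. -/
def HasNextStates (M : MDP S A) (sp sm : S → A → S) : Prop :=
  ∀ s a s', s' ≠ sp s a → s' ≠ sm s a → M.trans s a s' = 0

section Value

variable [Fintype S]

/-- `M.expReward π n h s` is the expected reward `n` steps from now, when the policy `π` is followed
in `M`, the current state is `s` and the states seen before are `h`. -/
noncomputable def expReward (M : MDP S A) (π : Policy S A) : ℕ → List S → S → ℝ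
  | 0, _, s => M.reward s
  | n + 1, h, s =>
      ∑ s', (M.trans s (π (h ++ [s])) s').toReal * M.expReward π n (h ++ [s]) s'

/-- The value of the policy `π` after the history `h ++ [s]`: the expected total discounted reward
from now on. The series is summable, because rewards lie in `[0, 1]`. -/
noncomputable def value (M : MDP S A) (π : Policy S A) (h : List S) (s : S) : ℝ :=
  ∑' n : ℕ, M.discount ^ n * M.expReward π n h s

/-- The optimal value of a state: the maximum of its values under the finitely many stationary
policies `σ : S → A`. The policy `fun h => σ (h.getLastD s)` plays `σ` in the current state; it is
only consulted at nonempty `h`, so that the default is never used. -/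
noncomputable def optValue (M : MDP S A) (s : S) : ℝ :=
  ⨆ σ : S → A, M.value (fun h => σ (h.getLastD s)) [] s

end Value

section Trajectory

variable [Finite S] [MeasurableSpace S] [DiscreteMeasurableSpace S]

/-- The conditional law of the state at time `n + 1` given the states at times `0, …, n`, when `π` is
followed in `M`. -/
noncomputable def stepKernel (M : MDP S A) (π : Policy S A) (n : ℕ) :
    Kernel ((i : Finset.Iic n) → S) S :=
  Kernel.ofFunOfCountable fun x =>
    (M.trans (x ⟨n, Finset.mem_Iic.2 le_rfl⟩)
      (π (List.ofFn fun i : Fin (n + 1) =>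
        x ⟨i, Finset.mem_Iic.2 (Nat.lt_succ_iff.1 i.isLt)⟩))).toMeasure

instance (M : MDP S A) (π : Policy S A) (n : ℕ) : IsMarkovKernel (M.stepKernel π n) :=
  ⟨fun _ => PMF.toMeasure.isProbabilityMeasure _⟩

/-- The law of the sequence of the states seen when `π` is followed in `M` from the state `s₁`; the
state at time `0` is `s₁`. -/
noncomputable def law (M : MDP S A) (π : Policy S A) (s₁ : S) : Measure (ℕ → S) :=
  Kernel.trajMeasure (X := fun _ => S) (Measure.dirac s₁) (M.stepKernel π)

end Trajectory

/-- The time-steps of the trajectory `ω` at which the policy `π` is more than `ε` worse than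
optimal. -/
def errorTimes [Fintype S] (M : MDP S A) (π : Policy S A) (ε : ℝ) (ω : ℕ → S) : Set ℕ :=
  {t | M.optValue (ω t) - M.value π (pastStates ω t) (ω t) > ε}

end MDP

/-! The policy is fixed before the MDP, so the bound is a change of measure between a reference MDP
M₀ and an MDP M₁ that differs from it in a single state/action pair. Let B be an event about the
first T states that allows at most m uses of this pair and has probability at least 1/2 under M₀.
Cauchy–Schwarz, applied one step at a time, gives B probability at least (1/4)/R^m under M₁, where R
= 1 + u is (a bound for) the second moment of the likelihood ratio of a single use
(`IsTwoPoint.sq_pathExp_mul_le`, `IsTwoPoint.le_law_errorTimes`). This is at least δ once m u ≤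
log(1/(12δ)) + 1 (`le_quarter_div_pow`). It remains to find, for the given policy, a pair that is
used rarely under M₀ and whose neglect causes N errors under M₁. Averaging over a number of
candidate pairs of order |S × A| yields it (`exists_measure_one_le_le`). The cubic power of 1 - γ is
reached by two constructions, according to the size of S compared with 1/(1 - γ).

If |S| is small, any state can be reached at negligible cost (`exists_hard_navigation`). One state
`top` has reward 1, all others reach it with probability 1 - γ, and M₁ multiplies this probability
by 1 + Δ for one pair, with Δ of order ε(1 - γ). As the perturbed probability is small, u is of
order (1 - γ)Δ². In M₀ all policies spend the same discounted time outside `top`, and at most one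
pair at a time can claim more than half of it. Hence an average pair is neglected at a constant
fraction of 4N time-steps, and each of these is an error in M₁.

If |S| is large, the states form a cycle of groups of duration about 1/(1 - γ) (`exists_hard_ring`).
In the middle third of a group the policy may leave the neutral track for a good or a bad one, until
the group ends. In M₀ every departure is a loss, foreseeable at e earlier time-steps with e of order
1/(1 - γ), so fewer than N errors leave room for at most N/e departures. Here u is of order Δ², and
the missing factor 1 - γ comes from m, which is of order N/(e |S × A|). In M₁ one departure is
profitable, and each revolution without it contains an error. If M₀ itself has N errors with
probability at least δ, then M₀ is the required MDP.

All values are estimated by sub- and supersolutions of Bellman equations on histories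
(`le_of_bellman`), which covers non-stationary policies. -/

/-- The number of nonempty prefixes of `l` that satisfy `p`. -/
noncomputable def listCount {S : Type*} (p : List S → Prop) (l : List S) : ℕ :=
  open Classical in ((Finset.range l.length).filter fun t => p (l.take (t + 1))).card

/-! ### Counting events along a history -/

section ListCount

open Classical in
lemma listCount_concat {S : Type*} (p : List S → Prop) (h : List S) (s : S) :
    listCount p (h ++ [s]) = listCount p h + if p (h ++ [s]) then 1 else 0 := by
  unfold listCount
  rw [List.length_append, List.length_singleton, Finset.range_add_one, Finset.filter_insert]
  have e : (Finset.range h.length).filter (fun t => p ((h ++ [s]).take (t + 1)))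
      = (Finset.range h.length).filter (fun t => p (h.take (t + 1))) := by
    refine Finset.filter_congr fun t ht => ?_
    rw [List.take_append_of_le_length (by simpa [Nat.succ_le_iff] using ht)]
  rw [e, List.take_of_length_le (l := h ++ [s]) (by simp)]
  split_ifs
  · rw [Finset.card_insert_of_notMem (by simp)]
  · simp

lemma pastStates_succ {S : Type*} (ω : ℕ → S) (t : ℕ) :
    pastStates ω (t + 1) = pastStates ω t ++ [ω t] := by
  unfold pastStates
  rw [List.ofFn_succ_last]
  simp

@[simp] lemma pastStates_zero {S : Type*} (ω : ℕ → S) : pastStates ω 0 = [] := by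
  simp [pastStates]

lemma listCount_pastStates {S : Type*} (p : List S → Prop) (ω : ℕ → S) (T : ℕ)
    [DecidablePred fun t => p (pastStates ω (t + 1))] :
    listCount p (pastStates ω T)
      = ((Finset.range T).filter fun t => p (pastStates ω (t + 1))).card := by
  classical
  induction T with
  | zero => simp [listCount]
  | succ T ih =>
    rw [pastStates_succ, listCount_concat, ih, Finset.range_add_one, Finset.filter_insert,
      ← pastStates_succ]
    split_ifs
    · rw [Finset.card_insert_of_notMem (by simp)]
    · simp

end ListCount

/-! ### Bellman equations and comparison for history-dependent policies -/

namespace MDP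

section Finite

variable {S A : Type*} [Fintype S]

lemma sum_trans_toReal (M : MDP S A) (s : S) (a : A) :
    ∑ s', (M.trans s a s').toReal = 1 := by
  have h := (M.trans s a).tsum_coe
  rw [tsum_fintype] at h
  rw [← ENNReal.toReal_sum (fun s' _ => (M.trans s a).apply_ne_top s'), h, ENNReal.toReal_one]

/-- The conditional expectation of `F` one step after the history `h ++ [s]`. -/
noncomputable def nextExp (M : MDP S A) (π : Policy S A) (F : List S → S → ℝ) (h : List S) (s : S) :
    ℝ :=
  ∑ s', (M.trans s (π (h ++ [s])) s').toReal * F (h ++ [s]) s'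

lemma nextExp_const (M : MDP S A) (π : Policy S A) (c : ℝ) (h : List S) (s : S) :
    M.nextExp π (fun _ _ => c) h s = c := by
  simp [nextExp, ← Finset.sum_mul, sum_trans_toReal]

lemma nextExp_mono (M : MDP S A) (π : Policy S A) {F G : List S → S → ℝ}
    (hFG : ∀ h s, F h s ≤ G h s) (h : List S) (s : S) : M.nextExp π F h s ≤ M.nextExp π G h s :=
  Finset.sum_le_sum fun _ _ => mul_le_mul_of_nonneg_left (hFG _ _) ENNReal.toReal_nonneg

lemma nextExp_sub (M : MDP S A) (π : Policy S A) (F G : List S → S → ℝ) (h : List S) (s : S) :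
    M.nextExp π (fun h s => F h s - G h s) h s = M.nextExp π F h s - M.nextExp π G h s := by
  simp [nextExp, mul_sub, Finset.sum_sub_distrib]

lemma nonpos_of_le_discount_nextExp (M : MDP S A) (π : Policy S A) {E : List S → S → ℝ} {C : ℝ}
    (hC : ∀ h s, E h s ≤ C) (hE : ∀ h s, E h s ≤ M.discount * M.nextExp π E h s)
    (h : List S) (s : S) : E h s ≤ 0 := by
  have h0 := M.discount_mem.1
  have key : ∀ n : ℕ, ∀ h s, E h s ≤ M.discount ^ n * C := by
    intro n
    induction n with
    | zero => simpa using hC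
    | succ n ih =>
      intro h s
      calc E h s ≤ M.discount * M.nextExp π E h s := hE h s
        _ ≤ M.discount * (M.discount ^ n * C) := by
          refine mul_le_mul_of_nonneg_left ?_ h0.le
          calc _ ≤ _ := M.nextExp_mono π ih h s
            _ = _ := M.nextExp_const π _ h s
        _ = _ := by ring
  have lim : Filter.Tendsto (fun n : ℕ => M.discount ^ n * C) Filter.atTop (nhds (0 * C)) :=
    (tendsto_pow_atTop_nhds_zero_of_lt_one h0.le M.discount_mem.2).mul_const C
  rw [zero_mul] at lim
  exact ge_of_tendsto' lim fun n => key n h s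

/-- Comparison principle: the difference of a subsolution and a supersolution is bounded above and
at most γ times its own expectation one step later, hence nonpositive. Every estimate of a value or
of a discounted count below amounts to exhibiting such an `F` or `G`. -/
lemma le_of_bellman (M : MDP S A) (π : Policy S A) (f : List S → S → ℝ) {F G : List S → S → ℝ}
    {C : ℝ} (hC : ∀ h s, F h s - G h s ≤ C)
    (hF : ∀ h s, F h s ≤ f h s + M.discount * M.nextExp π F h s)
    (hG : ∀ h s, f h s + M.discount * M.nextExp π G h s ≤ G h s) (h : List S) (s : S) :
    F h s ≤ G h s := by
  refine sub_nonpos.1 (M.nonpos_of_le_discount_nextExp π (E := fun h s => F h s - G h s) hC ?_ h s)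
  intro h s
  rw [nextExp_sub]
  nlinarith [hF h s, hG h s]

/-- The expectation of `f` after `n` further steps from the history `h ++ [s]`. -/
noncomputable def pathExp (M : MDP S A) (π : Policy S A) (f : List S → S → ℝ) :
    ℕ → List S → S → ℝ
  | 0 => f
  | n + 1 => M.nextExp π (M.pathExp π f n)

lemma pathExp_mem_Icc (M : MDP S A) (π : Policy S A) {f : List S → S → ℝ} {C : ℝ}
    (hf : ∀ h s, f h s ∈ Set.Icc 0 C) (n : ℕ) (h : List S) (s : S) :
    M.pathExp π f n h s ∈ Set.Icc 0 C := by
  induction n generalizing h s with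
  | zero => exact hf h s
  | succ n ih =>
    refine ⟨?_, ?_⟩
    · calc (0 : ℝ) = M.nextExp π (fun _ _ => 0) h s := (M.nextExp_const π 0 h s).symm
        _ ≤ _ := M.nextExp_mono π (fun h s => (ih h s).1) h s
    · calc _ ≤ M.nextExp π (fun _ _ => C) h s := M.nextExp_mono π (fun h s => (ih h s).2) h s
        _ = C := M.nextExp_const π C h s

/-- The expected discounted sum of `f` from the history `h ++ [s]` on. -/
noncomputable def discVal (M : MDP S A) (π : Policy S A) (f : List S → S → ℝ) (h : List S)
    (s : S) : ℝ :=
  ∑' n : ℕ, M.discount ^ n * M.pathExp π f n h s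

lemma summable_discVal (M : MDP S A) (π : Policy S A) {f : List S → S → ℝ} {C : ℝ}
    (hf : ∀ h s, f h s ∈ Set.Icc 0 C) (h : List S) (s : S) :
    Summable fun n : ℕ => M.discount ^ n * M.pathExp π f n h s := by
  refine Summable.of_nonneg_of_le (fun n => ?_) (fun n => ?_)
    ((summable_geometric_of_lt_one M.discount_mem.1.le M.discount_mem.2).mul_right C)
  · exact mul_nonneg (pow_nonneg M.discount_mem.1.le n) (M.pathExp_mem_Icc π hf n h s).1
  · exact mul_le_mul_of_nonneg_left (M.pathExp_mem_Icc π hf n h s).2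
      (pow_nonneg M.discount_mem.1.le n)

lemma discVal_mem_Icc (M : MDP S A) (π : Policy S A) {f : List S → S → ℝ} {C : ℝ}
    (hf : ∀ h s, f h s ∈ Set.Icc 0 C) (h : List S) (s : S) :
    M.discVal π f h s ∈ Set.Icc 0 (C / (1 - M.discount)) := by
  refine ⟨tsum_nonneg fun n => mul_nonneg (pow_nonneg M.discount_mem.1.le n)
    (M.pathExp_mem_Icc π hf n h s).1, ?_⟩
  have hg := summable_geometric_of_lt_one M.discount_mem.1.le M.discount_mem.2
  calc M.discVal π f h s ≤ ∑' n : ℕ, M.discount ^ n * C :=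
        (M.summable_discVal π hf h s).tsum_le_tsum (fun n => mul_le_mul_of_nonneg_left
          (M.pathExp_mem_Icc π hf n h s).2 (pow_nonneg M.discount_mem.1.le n)) (hg.mul_right C)
    _ = C / (1 - M.discount) := by
        rw [tsum_mul_right, tsum_geometric_of_lt_one M.discount_mem.1.le M.discount_mem.2]
        ring

lemma discVal_eq (M : MDP S A) (π : Policy S A) {f : List S → S → ℝ} {C : ℝ}
    (hf : ∀ h s, f h s ∈ Set.Icc 0 C) (h : List S) (s : S) :
    M.discVal π f h s = f h s + M.discount * M.nextExp π (M.discVal π f) h s := by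
  unfold discVal
  rw [(M.summable_discVal π hf h s).tsum_eq_zero_add]
  congr 1
  · simp [pathExp]
  · simp only [nextExp, pathExp, Finset.mul_sum]
    rw [Summable.tsum_finsetSum]
    · refine Finset.sum_congr rfl fun s' _ => ?_
      rw [← tsum_mul_left, ← tsum_mul_left]
      exact tsum_congr fun n => by ring
    · intro s' _
      have := (M.summable_discVal π hf (h ++ [s]) s').mul_left
        (M.discount * (M.trans s (π (h ++ [s])) s').toReal)
      exact this.congr fun n => by ring

lemma expReward_eq_pathExp (M : MDP S A) (π : Policy S A) (n : ℕ) (h : List S) (s : S) :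
    M.expReward π n h s = M.pathExp π (fun _ s => M.reward s) n h s := by
  induction n generalizing h s with
  | zero => rfl
  | succ n ih => simp [expReward, pathExp, nextExp, ih]

lemma value_eq_discVal (M : MDP S A) (π : Policy S A) (h : List S) (s : S) :
    M.value π h s = M.discVal π (fun _ s => M.reward s) h s := by
  simp [value, discVal, expReward_eq_pathExp]

lemma value_mem_Icc (M : MDP S A) (π : Policy S A) (h : List S) (s : S) :
    M.value π h s ∈ Set.Icc 0 (1 / (1 - M.discount)) := by
  rw [value_eq_discVal]
  exact M.discVal_mem_Icc π (fun _ s => M.reward_mem s) h s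

lemma value_eq (M : MDP S A) (π : Policy S A) (h : List S) (s : S) :
    M.value π h s = M.reward s + M.discount * M.nextExp π (M.value π) h s := by
  have e : M.value π = M.discVal π (fun _ s => M.reward s) := by
    funext h s
    exact M.value_eq_discVal π h s
  rw [e]
  exact M.discVal_eq π (fun _ s => M.reward_mem s) h s

lemma value_le_of_bellman (M : MDP S A) (π : Policy S A) {F : List S → S → ℝ} {C : ℝ}
    (hC : ∀ h s, C ≤ F h s)
    (hF : ∀ h s, M.reward s + M.discount * M.nextExp π F h s ≤ F h s) (h : List S) (s : S) :
    M.value π h s ≤ F h s :=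
  M.le_of_bellman π (fun _ s => M.reward s) (C := 1 / (1 - M.discount) - C)
    (fun h s => by linarith [hC h s, (M.value_mem_Icc π h s).2])
    (fun h s => (M.value_eq π h s).le) hF h s

lemma le_value_of_bellman (M : MDP S A) (π : Policy S A) {F : List S → S → ℝ} {C : ℝ}
    (hC : ∀ h s, F h s ≤ C)
    (hF : ∀ h s, F h s ≤ M.reward s + M.discount * M.nextExp π F h s) (h : List S) (s : S) :
    F h s ≤ M.value π h s :=
  M.le_of_bellman π (fun _ s => M.reward s) (C := C)
    (fun h s => by linarith [hC h s, (M.value_mem_Icc π h s).1])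
    hF (fun h s => (M.value_eq π h s).ge) h s

lemma le_optValue_of_bellman [Finite A] (M : MDP S A) (σ : S → A) {F : S → ℝ}
    (hF : ∀ s, F s ≤ M.reward s + M.discount * ∑ s', (M.trans s (σ s) s').toReal * F s') (s : S) :
    F s ≤ M.optValue s := by
  obtain ⟨C, hC⟩ := (Set.finite_range F).bddAbove
  have h1 : F s ≤ M.value (fun h => σ (h.getLastD s)) [] s := by
    refine M.le_value_of_bellman (fun h => σ (h.getLastD s)) (F := fun _ s => F s) (C := C)
      (fun _ s => hC ⟨s, rfl⟩) (fun h t => ?_) [] s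
    simpa [nextExp] using hF t
  exact h1.trans (le_ciSup (f := fun σ : S → A => M.value (fun h => σ (h.getLastD s)) [] s)
    (Set.finite_range _).bddAbove σ)

end Finite

end MDP

/-! ### Two-point transitions and the change of measure -/

namespace MDP

/-- In `M`, the pair `(s, a)` leads to `sp s a` with probability `P s a` and to `sm s a`
otherwise. -/
def IsTwoPoint {S A : Type*} [Fintype S] (M : MDP S A) (sp sm : S → A → S) (P : S → A → ℝ) : Prop :=
  ∀ s a (F : S → ℝ), ∑ s', (M.trans s a s').toReal * F s' = P s a * F (sp s a)
    + (1 - P s a) * F (sm s a)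

lemma exists_isTwoPoint {S A : Type*} [Fintype S] (sp sm : S → A → S) (P : S → A → ℝ)
    (hP : ∀ s a, P s a ∈ Set.Icc (0 : ℝ) 1) (r : S → ℝ) (hr : ∀ s, r s ∈ Set.Icc (0 : ℝ) 1)
    (γ : ℝ) (hγ : γ ∈ Set.Ioo (0 : ℝ) 1) :
    ∃ M : MDP S A, M.reward = r ∧ M.discount = γ ∧ M.HasNextStates sp sm ∧ M.IsTwoPoint sp sm P := by
  classical
  -- The two targets may coincide, hence a sum of two point masses instead of a case distinction.
  have hsum : ∀ s a, ∑ s', ((if s' = sp s a then ENNReal.ofReal (P s a) else 0)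
      + if s' = sm s a then ENNReal.ofReal (1 - P s a) else 0) = 1 := fun s a => by
    have h1 := (hP s a).1
    have h2 : 0 ≤ 1 - P s a := by linarith [(hP s a).2]
    simp [Finset.sum_add_distrib, ← ENNReal.ofReal_add h1 h2]
  let M : MDP S A :=
    { trans := fun s a => PMF.ofFintype _ (hsum s a)
      reward := r
      reward_mem := hr
      discount := γ
      discount_mem := hγ }
  have hM : ∀ s a s', M.trans s a s' = (if s' = sp s a then ENNReal.ofReal (P s a) else 0)
      + if s' = sm s a then ENNReal.ofReal (1 - P s a) else 0 := fun s a s' => rfl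
  refine ⟨M, rfl, rfl, fun s a s' h1 h2 => by simp [hM, h1, h2], fun s a F => ?_⟩
  have : ∀ s', (M.trans s a s').toReal * F s' = (if s' = sp s a then P s a * F s' else 0)
      + if s' = sm s a then (1 - P s a) * F s' else 0 := by
    intro s'
    rw [hM, ENNReal.toReal_add (by split_ifs <;> simp) (by split_ifs <;> simp)]
    have h1 := (hP s a).1
    have h2 : 0 ≤ 1 - P s a := by linarith [(hP s a).2]
    split_ifs <;> simp [ENNReal.toReal_ofReal h1, ENNReal.toReal_ofReal h2]
    all_goals ring
  simp [this, Finset.sum_add_distrib]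

lemma IsTwoPoint.nextExp_eq {S A : Type*} [Fintype S] {M : MDP S A} {sp sm : S → A → S}
    {P : S → A → ℝ} (hM : M.IsTwoPoint sp sm P) (π : Policy S A) (F : List S → S → ℝ) (h : List S)
    (s : S) : M.nextExp π F h s = P s (π (h ++ [s])) * F (h ++ [s]) (sp s (π (h ++ [s])))
      + (1 - P s (π (h ++ [s]))) * F (h ++ [s]) (sm s (π (h ++ [s]))) :=
  hM _ _ _

section ChangeOfMeasure

variable {S A : Type*} [Fintype S]

/-- Cauchy–Schwarz for the vectors (p/√q, (1-p)/√(1-q)) and (√q x, √(1-q) y); the square in the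
proof is the defect in Lagrange's identity. -/
lemma sq_two_point_le {p q x y : ℝ} (hq0 : 0 < q) (hq1 : q < 1) :
    (p * x + (1 - p) * y) ^ 2
      ≤ (p ^ 2 / q + (1 - p) ^ 2 / (1 - q)) * (q * x ^ 2 + (1 - q) * y ^ 2) := by
  have h1 : 0 < 1 - q := by linarith
  rw [div_add_div _ _ hq0.ne' h1.ne', div_mul_eq_mul_div, le_div_iff₀ (mul_pos hq0 h1)]
  have := sq_nonneg (p * (1 - q) * y - (1 - p) * q * x)
  nlinarith [this]

/-- Induction on the number of remaining steps. A step that uses the pair costs a factor `R` by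
Cauchy–Schwarz, which the count in the exponent on the left pays for. Every other step has the same
law in both MDPs, and convexity of the square suffices. At the end the count is at most `m` on `B`.
-/
lemma IsTwoPoint.sq_pathExp_mul_le {M₀ M₁ : MDP S A} {sp sm : S → A → S} {P₀ P₁ : S → A → ℝ}
    (h₀ : M₀.IsTwoPoint sp sm P₀) (h₁ : M₁.IsTwoPoint sp sm P₁)
    (hP₁ : ∀ s a, P₁ s a ∈ Set.Icc (0 : ℝ) 1) (s₀ : S) (a₀ : A)
    (hP : ∀ s a, (s = s₀ → a = a₀ → False) → P₀ s a = P₁ s a) (hlo : 0 < P₁ s₀ a₀)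
    (hhi : P₁ s₀ a₀ < 1) {R : ℝ} (hR1 : 1 ≤ R)
    (hR : P₀ s₀ a₀ ^ 2 / P₁ s₀ a₀ + (1 - P₀ s₀ a₀) ^ 2 / (1 - P₁ s₀ a₀) ≤ R)
    (π : Policy S A) (m : ℕ) {B : Set (List S)}
    (hB : ∀ l ∈ B, listCount (fun l => l.getLast? = some s₀ ∧ π l = a₀) l ≤ m) (n : ℕ) (h : List S)
    (s : S) :
    (M₀.pathExp π (fun h s => B.indicator 1 (h ++ [s])) n h s) ^ 2
        * R ^ listCount (fun l => l.getLast? = some s₀ ∧ π l = a₀) h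
      ≤ M₁.pathExp π (fun h s => B.indicator 1 (h ++ [s])) n h s * R ^ m := by
  classical
  induction n generalizing h s with
  | zero =>
    simp only [pathExp]
    by_cases hl : h ++ [s] ∈ B
    · have := hB _ hl
      rw [listCount_concat] at this
      simp only [Set.indicator_of_mem hl, Pi.one_apply, one_pow, one_mul]
      exact pow_le_pow_right₀ hR1 (by omega)
    · simp [hl]
  | succ n ih =>
    simp only [pathExp]
    rw [h₀.nextExp_eq, h₁.nextExp_eq]
    set a := π (h ++ [s]) with ha
    have ihp := ih (h ++ [s]) (sp s a)
    have ihm := ih (h ++ [s]) (sm s a)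
    rw [listCount_concat] at ihp ihm
    set x := M₀.pathExp π (fun h s => B.indicator 1 (h ++ [s])) n (h ++ [s]) (sp s a)
    set y := M₀.pathExp π (fun h s => B.indicator 1 (h ++ [s])) n (h ++ [s]) (sm s a)
    set x' := M₁.pathExp π (fun h s => B.indicator 1 (h ++ [s])) n (h ++ [s]) (sp s a)
    set y' := M₁.pathExp π (fun h s => B.indicator 1 (h ++ [s])) n (h ++ [s]) (sm s a)
    set c := listCount (fun l => l.getLast? = some s₀ ∧ π l = a₀) h
    obtain ⟨hq0, hq1⟩ := hP₁ s a
    have hq1' : 0 ≤ 1 - P₁ s a := by linarith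
    have hRc : 0 < R ^ c := by positivity
    by_cases hs : s = s₀ ∧ a = a₀
    · have hcond : (h ++ [s]).getLast? = some s₀ ∧ π (h ++ [s]) = a₀ := by
        exact ⟨by simp [hs.1], ha.symm.trans hs.2⟩
      rw [if_pos hcond] at ihp ihm
      have hsq := sq_two_point_le (p := P₀ s a) (x := x) (y := y) (hs.1 ▸ hs.2 ▸ hlo)
        (hs.1 ▸ hs.2 ▸ hhi : P₁ s a < 1)
      have hR' : P₀ s a ^ 2 / P₁ s a + (1 - P₀ s a) ^ 2 / (1 - P₁ s a) ≤ R := hs.1 ▸ hs.2 ▸ hR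
      have hnn : 0 ≤ P₁ s a * x ^ 2 + (1 - P₁ s a) * y ^ 2 := by positivity
      calc _ ≤ (R * (P₁ s a * x ^ 2 + (1 - P₁ s a) * y ^ 2)) * R ^ c :=
            mul_le_mul_of_nonneg_right (hsq.trans (mul_le_mul_of_nonneg_right hR' hnn)) hRc.le
        _ = P₁ s a * (x ^ 2 * R ^ (c + 1)) + (1 - P₁ s a) * (y ^ 2 * R ^ (c + 1)) := by ring
        _ ≤ P₁ s a * (x' * R ^ m) + (1 - P₁ s a) * (y' * R ^ m) :=
            add_le_add (mul_le_mul_of_nonneg_left ihp hq0) (mul_le_mul_of_nonneg_left ihm hq1')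
        _ = _ := by ring
    · have hcond : ¬ ((h ++ [s]).getLast? = some s₀ ∧ π (h ++ [s]) = a₀) := by
        simpa [← ha] using hs
      rw [if_neg hcond, add_zero] at ihp ihm
      rw [hP s a fun h1 h2 => hs ⟨h1, h2⟩]
      have hsq : (P₁ s a * x + (1 - P₁ s a) * y) ^ 2 ≤ P₁ s a * x ^ 2 + (1 - P₁ s a) * y ^ 2 := by
        nlinarith [mul_nonneg (mul_nonneg hq0 hq1') (sq_nonneg (x - y))]
      calc _ ≤ (P₁ s a * x ^ 2 + (1 - P₁ s a) * y ^ 2) * R ^ c :=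
            mul_le_mul_of_nonneg_right hsq hRc.le
        _ = P₁ s a * (x ^ 2 * R ^ c) + (1 - P₁ s a) * (y ^ 2 * R ^ c) := by ring
        _ ≤ P₁ s a * (x' * R ^ m) + (1 - P₁ s a) * (y' * R ^ m) :=
            add_le_add (mul_le_mul_of_nonneg_left ihp hq0) (mul_le_mul_of_nonneg_left ihm hq1')
        _ = _ := by ring

end ChangeOfMeasure

/-! ### The law of the trajectory -/

section Law

variable {S A : Type*} [Fintype S] [MeasurableSpace S] [DiscreteMeasurableSpace S]

instance (M : MDP S A) (π : Policy S A) (s₁ : S) : IsProbabilityMeasure (M.law π s₁) := by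
  unfold law; infer_instance

lemma measurable_pastStates {S : Type*} [Finite S] [MeasurableSpace S] [DiscreteMeasurableSpace S] {β : Type*} [MeasurableSpace β] (F : List S → β) (n : ℕ) :
    Measurable fun ω : ℕ → S => F (pastStates ω n) := by
  have h1 : Measurable fun ω : ℕ → S => fun i : Fin n => ω i :=
    measurable_pi_lambda _ fun i => measurable_pi_apply _
  have h2 : Measurable fun x : Fin n → S => F (List.ofFn x) := Measurable.of_discrete
  exact h2.comp h1

/-- The joint law of the first `n + 1` states and the next one is the composition product of the
marginal with the step kernel. -/
lemma lintegral_succ (M : MDP S A) (π : Policy S A) (s₁ : S) (g : List S → S → ENNReal) (n : ℕ) :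
    ∫⁻ ω, g (pastStates ω (n + 1)) (ω (n + 1)) ∂(M.law π s₁)
      = ∫⁻ ω, ∑ s', M.trans (ω n) (π (pastStates ω (n + 1))) s' * g (pastStates ω (n + 1)) s'
          ∂(M.law π s₁) := by
  let L : ((i : Finset.Iic n) → S) → List S := fun x =>
    List.ofFn fun i : Fin (n + 1) => x ⟨i, Finset.mem_Iic.2 (Nat.lt_succ_iff.1 i.isLt)⟩
  let G : ((i : Finset.Iic n) → S) × S → ENNReal := fun x => g (L x.1) x.2
  have hG : Measurable G := Measurable.of_discrete
  have key := Kernel.map_frestrictLe_trajMeasure_compProd_eq_map_trajMeasure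
    (X := fun _ => S) (μ₀ := Measure.dirac s₁) (κ := M.stepKernel π) (a := n)
  have h1 : ∫⁻ ω, g (pastStates ω (n + 1)) (ω (n + 1)) ∂(M.law π s₁)
      = ∫⁻ x, G x ∂((M.law π s₁).map fun x => (Preorder.frestrictLe n x, x (n + 1))) := by
    rw [lintegral_map hG (by fun_prop)]
    rfl
  rw [h1]
  unfold law
  rw [← key, Measure.lintegral_compProd hG, lintegral_map Measurable.of_discrete (by fun_prop)]
  refine lintegral_congr fun ω => ?_
  rw [lintegral_fintype]
  refine Finset.sum_congr rfl fun s' _ => ?_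
  rw [mul_comm]
  congr 1
  simp only [stepKernel, Kernel.ofFunOfCountable, Kernel.coe_mk]
  rw [PMF.toMeasure_apply_singleton _ _ (measurableSet_singleton _)]
  rfl

lemma ae_start (M : MDP S A) (π : Policy S A) (s₁ : S) : ∀ᵐ ω ∂(M.law π s₁), ω 0 = s₁ := by
  have h : (M.law π s₁).map (fun ω => ω 0) = Measure.dirac s₁ := by
    have e : (fun ω : ℕ → S => ω 0)
        = (fun x : (i : Finset.Iic 0) → S => x ⟨0, by simp⟩) ∘ Preorder.frestrictLe 0 := rfl
    rw [e, ← Measure.map_map (measurable_pi_apply _) (by fun_prop)]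
    unfold law Kernel.trajMeasure
    rw [Measure.map_comp _ _ (by fun_prop), Kernel.traj_map_frestrictLe, Kernel.partialTraj_self]
    rw [Measure.id_comp, Measure.map_map (measurable_pi_apply _) (by fun_prop)]
    exact Measure.map_id
  have h2 : ∀ᵐ x ∂((M.law π s₁).map fun ω => ω 0), x = s₁ := by
    rw [h]
    exact (ae_dirac_iff (p := fun x => x = s₁) (measurableSet_singleton _)).2 rfl
  exact ae_of_ae_map (measurable_pi_apply 0).aemeasurable h2

lemma ae_trans_ne_zero (M : MDP S A) (π : Policy S A) (s₁ : S) :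
    ∀ᵐ ω ∂(M.law π s₁), ∀ n, M.trans (ω n) (π (pastStates ω (n + 1))) (ω (n + 1)) ≠ 0 := by
  classical
  rw [ae_all_iff]
  intro n
  -- The indicator of an impossible step; its conditional expectation vanishes term by term.
  let g : List S → S → ENNReal := fun l s' =>
    l.getLast?.elim 0 fun s => if M.trans s (π l) s' = 0 then 1 else 0
  have hlast : ∀ ω : ℕ → S, (pastStates ω (n + 1)).getLast? = some (ω n) := fun ω => by
    simp [pastStates_succ]
  have h := M.lintegral_succ π s₁ g n
  have h0 : ∫⁻ ω, g (pastStates ω (n + 1)) (ω (n + 1)) ∂(M.law π s₁) = 0 := by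
    rw [h, ← lintegral_zero (μ := M.law π s₁)]
    refine lintegral_congr fun ω => Finset.sum_eq_zero fun s' _ => ?_
    simp only [g, hlast, Option.elim_some]
    split_ifs with h
    · simp [h]
    · simp
  have hmeas : Measurable fun ω : ℕ → S => g (pastStates ω (n + 1)) (ω (n + 1)) := by
    have : (fun ω : ℕ → S => g (pastStates ω (n + 1)) (ω (n + 1)))
        = fun ω => (fun l => l.getLast?.elim 0 fun s' => g l.dropLast s') (pastStates ω (n + 2)) := by
      funext ω
      rw [pastStates_succ ω (n + 1)]
      simp
    rw [this]
    exact measurable_pastStates (fun l => l.getLast?.elim 0 fun s' => g l.dropLast s') (n + 2)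
  rw [lintegral_eq_zero_iff hmeas] at h0
  filter_upwards [h0] with ω hω hz
  simp [g, hlast, hz] at hω

lemma IsTwoPoint.ae_step {M : MDP S A} {sp sm : S → A → S} {P : S → A → ℝ}
    (_hM : M.IsTwoPoint sp sm P) (hn : M.HasNextStates sp sm) (π : Policy S A) (s₁ : S) :
    ∀ᵐ ω ∂(M.law π s₁), ∀ n, ω (n + 1) = sp (ω n) (π (pastStates ω (n + 1)))
      ∨ ω (n + 1) = sm (ω n) (π (pastStates ω (n + 1))) := by
  filter_upwards [M.ae_trans_ne_zero π s₁] with ω hω n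
  by_contra! hc
  exact hω n (hn _ _ _ hc.1 hc.2)

lemma lintegral_pathExp (M : MDP S A) (π : Policy S A) (s₁ : S) {f : List S → S → ℝ}
    (hf : ∀ h s, f h s ∈ Set.Icc (0 : ℝ) 1) (k n : ℕ) :
    ∫⁻ ω, ENNReal.ofReal (M.pathExp π f k (pastStates ω n) (ω n)) ∂(M.law π s₁)
      = ∫⁻ ω, ENNReal.ofReal (f (pastStates ω (n + k)) (ω (n + k))) ∂(M.law π s₁) := by
  induction k generalizing n with
  | zero => rfl
  | succ k ih =>
    have e : n + (k + 1) = (n + 1) + k := by ring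
    rw [e, ← ih (n + 1),
      M.lintegral_succ π s₁ (fun h s => ENNReal.ofReal (M.pathExp π f k h s)) n]
    refine lintegral_congr fun ω => ?_
    simp only [pathExp, nextExp]
    rw [ENNReal.ofReal_sum_of_nonneg fun s' _ => mul_nonneg ENNReal.toReal_nonneg
      (M.pathExp_mem_Icc π hf _ _ _).1, ← pastStates_succ]
    refine Finset.sum_congr rfl fun s' _ => ?_
    rw [ENNReal.ofReal_mul ENNReal.toReal_nonneg, ENNReal.ofReal_toReal (PMF.apply_ne_top _ _)]

/-- The bridge between the measure on infinite trajectories and the finite recursion in which the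
change of measure is carried out. -/
lemma law_pastStates_mem (M : MDP S A) (π : Policy S A) (s₁ : S) (B : Set (List S)) (n : ℕ) :
    M.law π s₁ {ω | pastStates ω (n + 1) ∈ B}
      = ENNReal.ofReal (M.pathExp π (fun h s => B.indicator 1 (h ++ [s])) n [] s₁) := by
  classical
  have hf : ∀ (h : List S) (s : S), B.indicator (1 : List S → ℝ) (h ++ [s]) ∈ Set.Icc (0 : ℝ) 1 :=
    fun h s => by by_cases hb : h ++ [s] ∈ B <;> simp [hb]
  have h := M.lintegral_pathExp π s₁ hf n 0
  have h1 : ∫⁻ ω, ENNReal.ofReal (M.pathExp π (fun h s => B.indicator 1 (h ++ [s])) n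
      (pastStates ω 0) (ω 0)) ∂(M.law π s₁)
      = ENNReal.ofReal (M.pathExp π (fun h s => B.indicator 1 (h ++ [s])) n [] s₁) := by
    rw [lintegral_congr_ae (g := fun _ => ENNReal.ofReal
      (M.pathExp π (fun h s => B.indicator 1 (h ++ [s])) n [] s₁))]
    · simp
    · filter_upwards [M.ae_start π s₁] with ω hω
      simp [hω]
  have hm : MeasurableSet {ω : ℕ → S | pastStates ω (n + 1) ∈ B} :=
    (measurable_pastStates (fun l => l ∈ B) (n + 1)).setOf
  rw [← h1, h, ← lintegral_indicator_one hm]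
  refine lintegral_congr fun ω => ?_
  rw [zero_add, ← pastStates_succ]
  by_cases hb : pastStates ω (n + 1) ∈ B <;> simp [Set.indicator, hb]

lemma IsTwoPoint.sq_le_law {M₀ M₁ : MDP S A} {sp sm : S → A → S} {P₀ P₁ : S → A → ℝ}
    (h₀ : M₀.IsTwoPoint sp sm P₀) (h₁ : M₁.IsTwoPoint sp sm P₁)
    (hP₁ : ∀ s a, P₁ s a ∈ Set.Icc (0 : ℝ) 1) (s₀ : S) (a₀ : A)
    (hP : ∀ s a, (s = s₀ → a = a₀ → False) → P₀ s a = P₁ s a) (hlo : 0 < P₁ s₀ a₀)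
    (hhi : P₁ s₀ a₀ < 1) {R : ℝ} (hR1 : 1 ≤ R)
    (hR : P₀ s₀ a₀ ^ 2 / P₁ s₀ a₀ + (1 - P₀ s₀ a₀) ^ 2 / (1 - P₁ s₀ a₀) ≤ R)
    (π : Policy S A) (s₁ : S) (m T : ℕ) (hT : 0 < T) {B : Set (List S)}
    (hB : ∀ l ∈ B, listCount (fun l => l.getLast? = some s₀ ∧ π l = a₀) l ≤ m) {x : ℝ} (hx : 0 ≤ x)
    (hxB : ENNReal.ofReal x ≤ M₀.law π s₁ {ω | pastStates ω T ∈ B}) :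
    ENNReal.ofReal (x ^ 2 / R ^ m) ≤ M₁.law π s₁ {ω | pastStates ω T ∈ B} := by
  obtain ⟨n, rfl⟩ : ∃ n, T = n + 1 := ⟨T - 1, by omega⟩
  rw [law_pastStates_mem] at hxB ⊢
  have hf : ∀ (h : List S) (s : S), B.indicator (1 : List S → ℝ) (h ++ [s]) ∈ Set.Icc (0 : ℝ) 1 :=
    fun h s => by classical by_cases hb : h ++ [s] ∈ B <;> simp [hb]
  have key := h₀.sq_pathExp_mul_le h₁ hP₁ s₀ a₀ hP hlo hhi hR1 hR π m hB n [] s₁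
  have h0 := (M₀.pathExp_mem_Icc π hf n [] s₁).1
  have hx' := (ENNReal.ofReal_le_ofReal_iff h0).1 hxB
  refine ENNReal.ofReal_le_ofReal ?_
  have hRm : 0 < R ^ m := by positivity
  rw [div_le_iff₀ hRm]
  refine le_trans ?_ key
  have : listCount (fun l => l.getLast? = some s₀ ∧ π l = a₀) ([] : List S) = 0 := by
    simp [listCount]
  rw [this, pow_zero, mul_one]
  exact pow_le_pow_left₀ hx hx' 2

end Law

end MDP

/-! ### Averaging over pairs, and the numerical core -/

/-- Some index has an expectation not above the average; Markov's inequality for it. -/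
lemma exists_measure_one_le_le {Ω ι : Type*} [MeasurableSpace Ω] (μ : Measure Ω)
    [IsProbabilityMeasure μ] [Fintype ι] [Nonempty ι] (φ : ι → Ω → ℝ)
    (hφ : ∀ j, Measurable (φ j)) (h0 : ∀ j ω, 0 ≤ φ j ω) {K : ℝ}
    (hK : ∀ᵐ ω ∂μ, ∑ j, φ j ω ≤ K) :
    ∃ j, μ {ω | 1 ≤ φ j ω} ≤ ENNReal.ofReal (K / Fintype.card ι) := by
  have hK0 : 0 ≤ K := by
    obtain ⟨ω, hω⟩ := hK.exists
    exact (Finset.sum_nonneg fun j _ => h0 j ω).trans hω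
  have hsum : ∑ j, ∫⁻ ω, ENNReal.ofReal (φ j ω) ∂μ
      ≤ ∑ _j : ι, ENNReal.ofReal (K / Fintype.card ι) := by
    rw [← lintegral_finsetSum _ fun j _ => (hφ j).ennreal_ofReal]
    calc _ ≤ ∫⁻ _, ENNReal.ofReal K ∂μ := by
          refine lintegral_mono_ae ?_
          filter_upwards [hK] with ω hω
          rw [← ENNReal.ofReal_sum_of_nonneg fun j _ => h0 j ω]
          exact ENNReal.ofReal_le_ofReal hω
      _ = ENNReal.ofReal K := by simp
      _ = _ := by
          rw [← ENNReal.ofReal_sum_of_nonneg fun j _ => by positivity]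
          simp only [Finset.sum_const, Finset.card_univ, nsmul_eq_mul]
          rw [mul_div_cancel₀ _ (by positivity)]
  obtain ⟨j, hj⟩ : ∃ j, ∫⁻ ω, ENNReal.ofReal (φ j ω) ∂μ ≤ ENNReal.ofReal (K / Fintype.card ι) := by
    by_contra! hc
    exact absurd hsum
      (ENNReal.sum_lt_sum_of_nonempty Finset.univ_nonempty fun j _ => hc j).not_ge
  refine ⟨j, le_trans ?_ hj⟩
  have h := mul_meas_ge_le_lintegral (μ := μ) (hφ j).ennreal_ofReal 1
  rw [one_mul] at h
  refine le_trans (measure_mono fun ω hω => ?_) h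
  simpa using hω

/-- In the applications `Q = |S × A|` and `x = ε²(1-γ)³`. Rounding up adds at most 1 to c₁QL/x, so
the exponent m u is at most L + 1, and R^m ≤ e · 1/(12δ) ≤ 1/(4δ). Thus 12 = 3 · 4, where 3 bounds e
(the price of rounding) and 1/4 is the square of the probability 1/2. -/
lemma le_quarter_div_pow {Q x D c₁ δ R u : ℝ} {m : ℕ} (hQ : 1 ≤ Q) (hx : 0 < x) (hD : 0 < D)
    (hxD : D * x ≤ 1) (hc : D * c₁ ≤ 1) (hc0 : 0 < c₁) (hδ : 0 < δ) (hδ1 : δ < 1 / 12) (hR : 1 ≤ R)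
    (hRu : R ≤ 1 + u) (hm : m * u ≤ D * x * ⌈c₁ * Q / x * Real.log (1 / 12 / δ)⌉₊ / Q) :
    δ ≤ (1 / 2) ^ 2 / R ^ m := by
  have hQ0 : 0 < Q := by linarith
  set L := Real.log (1 / 12 / δ) with hL
  have hL0 : 0 < L := Real.log_pos (by rw [lt_div_iff₀ hδ]; linarith)
  have hN : (⌈c₁ * Q / x * L⌉₊ : ℝ) ≤ c₁ * Q / x * L + 1 := (Nat.ceil_lt_add_one (by positivity)).le
  have h1 : m * u ≤ L + 1 := by
    refine hm.trans ?_
    rw [div_le_iff₀ hQ0]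
    calc D * x * ⌈c₁ * Q / x * L⌉₊ ≤ D * x * (c₁ * Q / x * L + 1) :=
          mul_le_mul_of_nonneg_left hN (by positivity)
      _ = (D * c₁) * (L * Q) + D * x := by field_simp
      _ ≤ 1 * (L * Q) + 1 := add_le_add (mul_le_mul_of_nonneg_right hc (by positivity)) hxD
      _ ≤ (L + 1) * Q := by nlinarith
  have h2 : R ^ m ≤ 3 * (1 / 12 / δ) := by
    calc R ^ m ≤ (Real.exp u) ^ m :=
          pow_le_pow_left₀ (by linarith) (by linarith [Real.add_one_le_exp u]) m
      _ = Real.exp (m * u) := (Real.exp_nat_mul u m).symm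
      _ ≤ Real.exp (L + 1) := Real.exp_le_exp.2 h1
      _ = (1 / 12 / δ) * Real.exp 1 := by rw [Real.exp_add, hL, Real.exp_log (by positivity)]
      _ ≤ (1 / 12 / δ) * 3 := by
          gcongr
          linarith [Real.exp_one_lt_d9]
      _ = _ := by ring
  have hR0 : 0 < R ^ m := by positivity
  rw [le_div_iff₀ hR0]
  calc δ * R ^ m ≤ δ * (3 * (1 / 12 / δ)) := by gcongr
    _ = (1 / 2) ^ 2 := by field_simp; norm_num

namespace MDP

lemma le_encard_errorTimes {S A : Type*} [Fintype S] {M : MDP S A} {π : Policy S A} {ε : ℝ}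
    {ω : ℕ → S} {N : ℕ} (s : Finset ℕ) (hs : N ≤ s.card)
    (h : ∀ t ∈ s, ε < M.optValue (ω t) - M.value π (pastStates ω t) (ω t)) :
    (N : ℕ∞) ≤ (M.errorTimes π ε ω).encard := by
  calc (N : ℕ∞) ≤ s.card := by exact_mod_cast hs
    _ = (s : Set ℕ).encard := (Set.encard_coe_eq_coe_finsetCard s).symm
    _ ≤ _ := Set.encard_le_encard fun t ht => h t ht

/-- The change of measure from `M₀` to `M₁` applied to an event that has probability at least `1/2`
under `M₀` and forces many errors under `M₁`. -/
lemma IsTwoPoint.le_law_errorTimes {S A : Type*} [Fintype S] [MeasurableSpace S]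
    [DiscreteMeasurableSpace S] {M₀ M₁ : MDP S A} {sp sm : S → A → S} {P₀ P₁ : S → A → ℝ}
    (h₀ : M₀.IsTwoPoint sp sm P₀) (h₁ : M₁.IsTwoPoint sp sm P₁)
    (hP₁ : ∀ s a, P₁ s a ∈ Set.Icc (0 : ℝ) 1) (s₀ : S) (a₀ : A)
    (hP : ∀ s a, (s = s₀ → a = a₀ → False) → P₀ s a = P₁ s a) (hlo : 0 < P₁ s₀ a₀)
    (hhi : P₁ s₀ a₀ < 1) {R : ℝ} (hR1 : 1 ≤ R)
    (hR : P₀ s₀ a₀ ^ 2 / P₁ s₀ a₀ + (1 - P₀ s₀ a₀) ^ 2 / (1 - P₁ s₀ a₀) ≤ R)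
    (π : Policy S A) (s₁ : S) (m T : ℕ) (hT : 0 < T) {B : Set (List S)}
    (hB : ∀ l ∈ B, listCount (fun l => l.getLast? = some s₀ ∧ π l = a₀) l ≤ m)
    (hhalf : M₀.law π s₁ {ω | pastStates ω T ∈ B}ᶜ ≤ ENNReal.ofReal (1 / 2)) {δ ε : ℝ} {N : ℕ}
    (hδ : δ ≤ (1 / 2) ^ 2 / R ^ m)
    (herr : ∀ᵐ ω ∂M₁.law π s₁, pastStates ω T ∈ B → (N : ℕ∞) ≤ (M₁.errorTimes π ε ω).encard) :
    ENNReal.ofReal δ ≤ M₁.law π s₁ {ω | (N : ℕ∞) ≤ (M₁.errorTimes π ε ω).encard} := by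
  have hm : MeasurableSet {ω : ℕ → S | pastStates ω T ∈ B} :=
    (measurable_pastStates (fun l => l ∈ B) T).setOf
  have hx : ENNReal.ofReal (1 / 2) ≤ M₀.law π s₁ {ω | pastStates ω T ∈ B} := by
    have h := prob_add_prob_compl (μ := M₀.law π s₁) hm
    have h2 : ENNReal.ofReal (1 / 2) + ENNReal.ofReal (1 / 2) = 1 := by
      rw [← ENNReal.ofReal_add (by norm_num) (by norm_num)]; norm_num
    rw [← h2] at h
    by_contra hc
    exact absurd h (ENNReal.add_lt_add_of_lt_of_le (ne_top_of_le_ne_top ENNReal.ofReal_ne_top hhalf)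
      (not_le.1 hc) hhalf).ne
  calc ENNReal.ofReal δ ≤ ENNReal.ofReal ((1 / 2) ^ 2 / R ^ m) := ENNReal.ofReal_le_ofReal hδ
    _ ≤ _ := h₀.sq_le_law h₁ hP₁ s₀ a₀ hP hlo hhi hR1 hR π s₁ m T hT hB (by norm_num) hx
    _ ≤ _ := measure_mono_ae herr

end MDP

/-! ### Navigation MDPs: values -/

namespace MDP

/-- In a navigation MDP every state other than `top` moves to `top` with a small probability `1 - γ`,
which the action `b` increases in the state `c` by the factor `1 + Δ`. -/
noncomputable def navProb {S A : Type*} (top : S) (γ : ℝ) (c : S) (b : A) (Δ : ℝ) (s : S) (a : A) :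
    ℝ :=
  open Classical in
  if s = top then γ else if s = c ∧ a = b then (1 - γ) * (1 + Δ) else 1 - γ

/-- The state to which a navigation MDP moves if it does not move to `top`: the action `a₀` follows
`nx`, the others stay. -/
noncomputable def navNext {S A : Type*} (top w₀ : S) (nx : S → S) (a₀ : A) (s : S) (a : A) : S :=
  open Classical in if s = top then w₀ else if a = a₀ then nx s else s

/-- The value of a state of a navigation MDP in which no action is better than the others. -/
noncomputable def navBase {S : Type*} (top : S) (γ D : ℝ) (s : S) : ℝ :=
  open Classical in if s = top then (1 + γ) * D else γ * D

/-- An upper bound for the discounted number of steps in which a policy that heads for a state at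
distance `d s` from `s` follows the navigation action. -/
noncomputable def navCost {S : Type*} (top : S) (m : ℕ) (d : S → ℕ) (s : S) : ℝ :=
  open Classical in if s = top then 3 * m + 2 else d s + 2 * m + 2

lemma navNext_ne_top {S A : Type*} {top w₀ : S} {nx : S → S} {a₀ : A}
    (hw₀ : w₀ ≠ top) (hnx : ∀ s, s ≠ top → nx s ≠ top) (s : S)
    (a : A) :
    navNext top w₀ nx a₀ s a ≠ top := by
  unfold navNext
  split_ifs with h1 h2
  exacts [hw₀, hnx s h1, h1]

section Navigation

variable {S A : Type*} [Fintype S] {top w₀ c : S} {nx : S → S} {a₀ b : A} {γ Δ D : ℝ}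

/-- Each use of the pair gains γ(1-γ)ΔD, because the unperturbed values of `top` and of any other
state differ by D. The count `G` is taken under `M₀`, while `M₁` moves to `top` a little more often.
As (1-γ)G ≤ 1, this changes the count after a use by at most 2Δ relative to the use itself, which
the factor 1 + 2Δ absorbs. -/
lemma value_le_navigation {M₀ M₁ : MDP S A} (hγ0 : 0 < γ) (hγ1 : γ < 1)
    (hD : D * (1 - γ) * (1 + 2 * γ) = 1) (hΔ0 : 0 ≤ Δ) (hΔ1 : Δ ≤ 1 / 2)
    (hw₀ : w₀ ≠ top) (hnx : ∀ s, s ≠ top → nx s ≠ top) (hc : c ≠ top)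
    (h₀ : M₀.IsTwoPoint (fun _ _ => top) (navNext top w₀ nx a₀) (navProb top γ c b 0))
    (h₁ : M₁.IsTwoPoint (fun _ _ => top) (navNext top w₀ nx a₀) (navProb top γ c b Δ))
    (hr : M₁.reward = open Classical in fun s => if s = top then 1 else 0) (hd : M₁.discount = γ)
    (π : Policy S A) {G : List S → S → ℝ} (hG0 : ∀ h s, 0 ≤ G h s)
    (hG1 : ∀ h s, (1 - γ) * G h s ≤ 1)
    (hG : ∀ h s, G h s = (open Classical in if s = c ∧ π (h ++ [s]) = b then 1 else 0)
      + γ * M₀.nextExp π G h s) (h : List S) (s : S) :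
    M₁.value π h s ≤ navBase top γ D s
      + γ * (1 - γ) * Δ * D * (1 + 2 * Δ) * G h s := by
  classical
  have hη : 0 < 1 - γ := by linarith
  have hD0 : 0 < D := by
    by_contra! hneg
    nlinarith [mul_pos hη (by linarith : 0 < 1 + 2 * γ)]
  have hV0 : ∀ s, 0 ≤ navBase top γ D s := fun s => by unfold navBase; split_ifs <;> positivity
  refine M₁.value_le_of_bellman π (C := 0) (F := fun h s => navBase top γ D s
      + γ * (1 - γ) * Δ * D * (1 + 2 * Δ) * G h s)
      (fun h s => add_nonneg (hV0 s) (mul_nonneg (by positivity) (hG0 h s))) (fun h s => ?_) h s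
  have hGs := hG h s
  rw [h₀.nextExp_eq] at hGs
  rw [h₁.nextExp_eq, hd]
  have hg1 := hG0 (h ++ [s]) top
  have hg1' := hG1 (h ++ [s]) top
  have hg2 := hG0 (h ++ [s]) (navNext top w₀ nx a₀ s (π (h ++ [s])))
  set a := π (h ++ [s])
  set g₁ := G (h ++ [s]) top
  set g₂ := G (h ++ [s]) (navNext top w₀ nx a₀ s a)
  have hsm : navBase top γ D (navNext top w₀ nx a₀ s a) = γ * D := by
    simp [navBase, navNext_ne_top hw₀ hnx s a]
  have htop : navBase top γ D top = (1 + γ) * D := by simp [navBase]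
  simp only [hsm, htop, hr]
  by_cases hs : s = top
  · have hsc : ¬ (s = c ∧ a = b) := fun hh => hc (hh.1 ▸ hs)
    rw [if_neg hsc] at hGs
    simp only [navProb, navBase, hs, if_true] at hGs ⊢
    rw [hGs]
    refine le_of_eq ?_
    linear_combination -hD
  · by_cases hsc : s = c ∧ a = b
    · simp only [navProb, navBase, hsc, and_self, if_true] at hGs ⊢
      rw [if_neg hc] at hGs ⊢
      simp only [hc, if_false]
      rw [hGs]
      have key : γ * (1 - γ) * Δ * D * ((1 + 2 * Δ) * γ * Δ * ((1 - γ) * g₁))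
          ≤ γ * (1 - γ) * Δ * D * (2 * Δ) := by
        refine mul_le_mul_of_nonneg_left ?_ (by positivity)
        calc (1 + 2 * Δ) * γ * Δ * ((1 - γ) * g₁) ≤ 2 * 1 * Δ * 1 := by
              gcongr
              linarith
          _ = _ := by ring
      have key2 : 0 ≤ γ * (1 - γ) * Δ * D * ((1 + 2 * Δ) * γ * Δ * ((1 - γ) * g₂)) := by
        positivity
      nlinarith [key, key2, hD]
    · rw [if_neg hsc] at hGs
      simp only [navProb, navBase, hs, hsc, if_false] at hGs ⊢
      rw [hGs]
      refine le_of_eq ?_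
      ring

/-- A subsolution for the policy that walks to `c` and then plays `b`. The discounted time outside
`top` is 1/(1-γ) - `navBase`, and `navCost` is what the walk takes from it: each return from `top`
costs at most `m` further steps, but such restarts have probability about 1 - γ per step, so their
discounted cost is only a multiple of `m`. The constant γΔD pays (1-γ)γΔD per step, exactly the loss
from leaving `c` more often in `M₁`. -/
lemma le_optValue_navigation [Finite A] {M₁ : MDP S A} (hγ0 : 0 < γ) (hγ1 : γ < 1)
    (hD : D * (1 - γ) * (1 + 2 * γ) = 1) (hΔ0 : 0 ≤ Δ) (hΔ1 : Δ ≤ 1 / 2)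
    (hw₀ : w₀ ≠ top) (hnx : ∀ s, s ≠ top → nx s ≠ top) (hc : c ≠ top) (hb : b ≠ a₀)
    {m : ℕ} {d : S → ℕ} (hdc : d c = 0) (hdm : ∀ s, d s ≤ m)
    (hdnx : ∀ s, s ≠ top → s ≠ c → d (nx s) + 1 ≤ d s)
    (h₁ : M₁.IsTwoPoint (fun _ _ => top) (navNext top w₀ nx a₀) (navProb top γ c b Δ))
    (hr : M₁.reward = open Classical in fun s => if s = top then 1 else 0) (hd : M₁.discount = γ)
    (s : S) :
    navBase top γ D s + γ * (1 - γ) * Δ * D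
      * (1 / (1 - γ) - navBase top γ D s - navCost top m d s - γ * Δ * D) ≤ M₁.optValue s := by
  classical
  have hη : 0 < 1 - γ := by linarith
  have hD0 : 0 < D := by
    by_contra! hneg
    nlinarith [mul_pos hη (by linarith : 0 < 1 + 2 * γ)]
  obtain ⟨i, hi⟩ : ∃ i, i = 1 / (1 - γ) := ⟨_, rfl⟩
  have hiη : i * (1 - γ) = 1 := by rw [hi]; field_simp
  rw [← hi]
  refine M₁.le_optValue_of_bellman (fun s => if s = c then b else a₀)
    (F := fun s => navBase top γ D s + γ * (1 - γ) * Δ * D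
      * (i - navBase top γ D s - navCost top m d s - γ * Δ * D)) (fun s => ?_) s
  have hbp : 0 ≤ γ * (1 - γ) * Δ * D := by positivity
  have hK : 0 ≤ γ * Δ * D := by positivity
  rw [h₁, hd, hr]
  have htop : navBase top γ D top = (1 + γ) * D := by simp [navBase]
  have htopH : navCost top m d top = 3 * m + 2 := by simp [navCost]
  have hbase : ∀ x, x ≠ top → navBase top γ D x = γ * D := fun x hx => by simp [navBase, hx]
  have hcost : ∀ x, x ≠ top → navCost top m d x = d x + 2 * m + 2 := fun x hx => by
    simp [navCost, hx]
  have hm0 : (0 : ℝ) ≤ m := Nat.cast_nonneg m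
  by_cases hs : s = top
  · subst hs
    have e : ∀ a : A, navNext s w₀ nx a₀ s a = w₀ := fun a => by simp [navNext]
    simp only [e, htop, htopH, hbase w₀ hw₀, hcost w₀ hw₀, navProb, if_true]
    have hdm' : (d w₀ : ℝ) ≤ m := by exact_mod_cast hdm w₀
    have key : γ * (γ * (3 * m + 2) + (1 - γ) * (d w₀ + 2 * m + 2)) ≤ 3 * m + 2 := by
      have h1 : γ * (3 * m + 2) + (1 - γ) * (d w₀ + 2 * m + 2) ≤ 3 * m + 2 := by nlinarith
      nlinarith
    nlinarith [mul_le_mul_of_nonneg_left key hbp, mul_nonneg hbp (mul_nonneg hη.le hK)]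
  · by_cases hsc : s = c
    · subst hsc
      have e : navNext top w₀ nx a₀ s b = s := by simp [navNext, hs, hb]
      simp only [if_true, e, htop, htopH, hbase s hs, hcost s hs, navProb, hs, if_false, and_self,
        hdc, Nat.cast_zero, zero_add]
      have key : γ * ((1 - γ) * (1 + Δ) * (3 * m + 2) + (1 - (1 - γ) * (1 + Δ)) * (2 * m + 2))
          ≤ 2 * m + 2 := by
        have h2 : 0 ≤ (1 - γ) * m := by positivity
        have h3 : γ * (1 + Δ) ≤ 2 := by nlinarith
        nlinarith [mul_le_mul_of_nonneg_right h3 h2]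
      nlinarith [mul_le_mul_of_nonneg_left key hbp]
    · have e : navNext top w₀ nx a₀ s a₀ = nx s := by simp [navNext, hs]
      have hnxs := hnx s hs
      simp only [hsc, if_false, e, htop, htopH, hbase s hs, hcost s hs, hbase _ hnxs,
        hcost _ hnxs, navProb, hs, false_and]
      have hdn : (d (nx s) : ℝ) + 1 ≤ d s := by exact_mod_cast hdnx s hs hsc
      have hdn0 : (0 : ℝ) ≤ d (nx s) := Nat.cast_nonneg _
      have key : γ * ((1 - γ) * (3 * m + 2) + (1 - (1 - γ)) * (d (nx s) + 2 * m + 2)) + 1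
          ≤ d s + 2 * m + 2 := by
        have h2 : 0 ≤ (1 - γ) * m := by positivity
        have h4 : 0 ≤ (1 - γ) * (d (nx s) : ℝ) := by positivity
        nlinarith [mul_nonneg hγ0.le h2, mul_nonneg hγ0.le h4]
      nlinarith [mul_le_mul_of_nonneg_left key hbp, mul_nonneg hbp (mul_nonneg hη.le hK)]

end Navigation

end MDP

namespace MDP

lemma navProb_zero {S A : Type*} (top : S) (γ : ℝ) (c : S) (b : A) :
    navProb top γ c b 0 = open Classical in fun s _ => if s = top then γ else 1 - γ := by
  funext s a
  simp [navProb]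

/-- All states but one are placed on a single cycle, and `d` is the number of steps to `c` along it.
-/
lemma exists_cyclic_navigation (S : Type*) [Fintype S] (hS : 2 ≤ Fintype.card S) :
    ∃ (top w₀ : S) (nx : S → S), w₀ ≠ top ∧ (∀ s, s ≠ top → nx s ≠ top) ∧
      ∀ c, c ≠ top → ∃ d : S → ℕ, d c = 0 ∧ (∀ s, d s ≤ Fintype.card S) ∧
        ∀ s, s ≠ top → s ≠ c → d (nx s) + 1 ≤ d s := by
  obtain ⟨m, hm⟩ : ∃ m, Fintype.card S = m + 1 := ⟨Fintype.card S - 1, by omega⟩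
  let e : S ≃ Fin (m + 1) := Fintype.equivFinOfCardEq hm
  have hm1 : 1 ≤ m := by omega
  have hval : ∀ (k : ℕ) (hk : k < m + 1), (e (e.symm ⟨k, hk⟩)).val = k := fun k hk => by simp
  have hne : ∀ s t : S, s ≠ t → (e s).val ≠ (e t).val := fun s t hst h =>
    hst (e.injective (Fin.ext h))
  let top : S := e.symm ⟨m, by omega⟩
  have htop : (e top).val = m := hval _ _
  have hlt : ∀ s, s ≠ top → (e s).val < m := fun s hs => by
    have := hne s top hs
    have := (e s).isLt
    omega
  let nx : S → S := fun s => if h : (e s).val + 1 < m then e.symm ⟨(e s).val + 1, by omega⟩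
    else e.symm ⟨0, by omega⟩
  have hnx : ∀ s, (e (nx s)).val = if (e s).val + 1 < m then (e s).val + 1 else 0 := fun s => by
    simp only [nx]
    split_ifs
    · exact hval _ _
    · exact hval _ _
  have hnt : ∀ s : S, (e s).val ≠ m → s ≠ top := fun s hs h => hs (h ▸ htop)
  refine ⟨top, e.symm ⟨0, by omega⟩, nx, hnt _ (by rw [hval]; omega), fun s hs => hnt _ ?_,
    fun c hc => ?_⟩
  · rw [hnx]
    split_ifs <;> omega
  · have hcm := hlt c hc
    refine ⟨fun s => if (e s).val ≤ (e c).val then (e c).val - (e s).val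
      else (e c).val + m - (e s).val, by simp, fun s => ?_, fun s hs hsc => ?_⟩
    · have := (e s).isLt
      simp only
      split_ifs <;> omega
    · have h1 := hlt s hs
      have h2 := hne s c hsc
      simp only [hnx]
      split_ifs <;> omega

/-- With `i = 1/(1-γ)`, the total `W` is at least 0.3 i (this uses γ > 3/4), while `H` ≤ 0.06 i and
γΔD ≤ 0.004 i. So using the pair for at most half of `W` leaves a deficit of at least 0.08 i uses,
each worth at least 0.3Δ(1-γ)i = 0.3Δ. The factor 81 in `Δ` makes 0.3 · 0.08 · 81 exceed 1. -/
lemma lt_sub_of_navigation {γ ε Δ D B H V O g W i : ℝ} (hγ0 : 3 / 4 < γ) (hγ1 : γ < 1) (hε : 0 < ε)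
    (hi : i * (1 - γ) = 1) (hD : D * (1 - γ) * (1 + 2 * γ) = 1) (hΔ : Δ = 81 * (ε * (1 - γ)))
    (hΔ1 : Δ ≤ 1 / 100) (hW : W = i - B) (hB : B ≤ (1 + γ) * D) (hH : H * (1 - γ) ≤ 6 / 100)
    (hg : g ≤ W / 2)
    (hV : V ≤ B + γ * (1 - γ) * Δ * D * (1 + 2 * Δ) * g)
    (hO : B + γ * (1 - γ) * Δ * D * (W - H - γ * Δ * D) ≤ O) : ε < O - V := by
  have hη : 0 < 1 - γ := by linarith
  have hi0 : 0 < i := by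
    by_contra! h
    nlinarith
  have hD' : D * (1 + 2 * γ) = i := by
    have : (1 - γ) ≠ 0 := hη.ne'
    apply mul_right_cancel₀ this
    linarith
  have hD0 : 0 < D := by
    by_contra! h
    nlinarith
  have hΔ0 : 0 < Δ := by rw [hΔ]; positivity
  have hDi : D ≤ 4 / 10 * i := by nlinarith
  have hW1 : 3 / 10 * i ≤ W := by nlinarith
  have hH1 : H ≤ 6 / 100 * i := by
    have h1 := mul_le_mul_of_nonneg_right hH hi0.le
    have h2 : H * (1 - γ) * i = H := by rw [mul_assoc, mul_comm (1 - γ), hi, mul_one]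
    linarith
  have hK : γ * Δ * D ≤ 4 / 1000 * i := by
    calc γ * Δ * D ≤ 1 * (1 / 100) * (4 / 10 * i) := by gcongr
      _ = _ := by ring
  have hq : 8 / 100 * i ≤ W - H - γ * Δ * D - (1 + 2 * Δ) * g := by
    have h1 : (1 + 2 * Δ) * g ≤ (1 + 2 * Δ) * (W / 2) :=
      mul_le_mul_of_nonneg_left hg (by linarith)
    have h2 : Δ * W ≤ 1 / 100 * W := mul_le_mul_of_nonneg_right hΔ1 (by linarith)
    nlinarith
  have hb : 3 / 10 * Δ ≤ γ * (1 - γ) * Δ * D := by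
    have h1 : γ * (1 - γ) * D * (1 + 2 * γ) = γ := by
      linear_combination γ * hD
    have h2 : 3 / 10 ≤ γ * (1 - γ) * D := by nlinarith
    nlinarith
  have hfin : 3 / 10 * Δ * (8 / 100 * i) ≤ γ * (1 - γ) * Δ * D *
      (W - H - γ * Δ * D - (1 + 2 * Δ) * g) := by
    apply mul_le_mul hb hq (by positivity) (by positivity)
  have h3 : 3 / 10 * Δ * (8 / 100 * i) = 3 / 10 * 81 * 8 / 100 * ε := by
    rw [hΔ]
    linear_combination (3 / 10 * 81 * 8 / 100 * ε) * hi
  nlinarith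

section Navigation

variable {S A : Type*} [Fintype S] {top w₀ : S} {nx : S → S} {a₀ : A} {γ D : ℝ}

/-- At most one pair is used at each step, and only outside `top`. The reward counts the time at
`top`, so the discounted time outside it is the right-hand side, whatever the policy. -/
lemma sum_discVal_le_navigation {M₀ : MDP S A} (hγ1 : γ < 1)
    (hD : D * (1 - γ) * (1 + 2 * γ) = 1)
    (hw₀ : w₀ ≠ top) (hnx : ∀ s, s ≠ top → nx s ≠ top)
    (h₀ : M₀.IsTwoPoint (fun _ _ => top) (navNext top w₀ nx a₀)
      (open Classical in fun s _ => if s = top then γ else 1 - γ)) (hd : M₀.discount = γ)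
    (π : Policy S A) [Fintype {x : S × A // x.1 ≠ top ∧ x.2 ≠ a₀}] (h : List S) (s : S) :
    ∑ j : {x : S × A // x.1 ≠ top ∧ x.2 ≠ a₀}, M₀.discVal π
      (open Classical in fun h s => if s = j.1.1 ∧ π (h ++ [s]) = j.1.2 then (1 : ℝ) else 0) h s
      ≤ 1 / (1 - γ) - navBase top γ D s := by
  classical
  have hη : 0 < 1 - γ := by linarith
  have hf : ∀ (j : {x : S × A // x.1 ≠ top ∧ x.2 ≠ a₀}) (h : List S) (s : S),
      (if s = j.1.1 ∧ π (h ++ [s]) = j.1.2 then (1 : ℝ) else 0) ∈ Set.Icc (0 : ℝ) 1 :=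
    fun j h s => by split_ifs <;> simp
  have hone : ∀ (h : List S) (s : S), ∑ j : {x : S × A // x.1 ≠ top ∧ x.2 ≠ a₀},
      (if s = j.1.1 ∧ π (h ++ [s]) = j.1.2 then (1 : ℝ) else 0) ≤ if s = top then 0 else 1 := by
    intro h s
    rw [← Finset.sum_filter, Finset.sum_const, nsmul_eq_mul, mul_one]
    split_ifs with hs
    · have : (Finset.univ.filter fun j : {x : S × A // x.1 ≠ top ∧ x.2 ≠ a₀} =>
          s = j.1.1 ∧ π (h ++ [s]) = j.1.2) = ∅ := by
        refine Finset.filter_eq_empty_iff.2 fun j _ hj => j.2.1 (hj.1 ▸ hs)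
      simp [this]
    · have : (Finset.univ.filter fun j : {x : S × A // x.1 ≠ top ∧ x.2 ≠ a₀} =>
          s = j.1.1 ∧ π (h ++ [s]) = j.1.2).card ≤ 1 := by
        refine Finset.card_le_one.2 fun i hi j hj => ?_
        rw [Finset.mem_filter] at hi hj
        exact Subtype.ext (Prod.ext (hi.2.1.symm.trans hj.2.1) (hi.2.2.symm.trans hj.2.2))
      exact_mod_cast this
  obtain ⟨C, hC⟩ := (Set.finite_range fun s => ((Fintype.card {x : S × A // x.1 ≠ top ∧ x.2 ≠ a₀} : ℝ)
      * (1 / (1 - γ))) - (1 / (1 - γ) - navBase top γ D s)).bddAbove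
  refine M₀.le_of_bellman π (fun h s => if s = top then 0 else 1) (C := C)
    (F := fun h s => ∑ j : {x : S × A // x.1 ≠ top ∧ x.2 ≠ a₀}, M₀.discVal π
      (fun h s => if s = j.1.1 ∧ π (h ++ [s]) = j.1.2 then (1 : ℝ) else 0) h s)
    (G := fun h s => 1 / (1 - γ) - navBase top γ D s) (fun h s => ?_) (fun h s => ?_)
    (fun h s => ?_) h s
  · refine le_trans ?_ (hC ⟨s, rfl⟩)
    refine sub_le_sub_right ?_ _
    refine (Finset.sum_le_card_nsmul _ _ (1 / (1 - γ)) fun j _ => ?_).trans ?_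
    · rw [← hd]
      exact (M₀.discVal_mem_Icc π (hf j) h s).2
    · simp
  · have e : M₀.nextExp π (fun h s => ∑ j : {x : S × A // x.1 ≠ top ∧ x.2 ≠ a₀}, M₀.discVal π
        (fun h s => if s = j.1.1 ∧ π (h ++ [s]) = j.1.2 then (1 : ℝ) else 0) h s) h s
        = ∑ j : {x : S × A // x.1 ≠ top ∧ x.2 ≠ a₀}, M₀.nextExp π (M₀.discVal π
        (fun h s => if s = j.1.1 ∧ π (h ++ [s]) = j.1.2 then (1 : ℝ) else 0)) h s := by
      simp only [nextExp, Finset.mul_sum]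
      exact Finset.sum_comm
    rw [e, Finset.mul_sum]
    rw [Finset.sum_congr rfl fun j _ => M₀.discVal_eq π (hf j) h s, Finset.sum_add_distrib]
    exact add_le_add_left (hone h s) _
  · rw [h₀.nextExp_eq, hd]
    have hsm : navBase top γ D (navNext top w₀ nx a₀ s (π (h ++ [s]))) = γ * D := by
      simp [navBase, navNext_ne_top hw₀ hnx s]
    have htop : navBase top γ D top = (1 + γ) * D := by simp [navBase]
    simp only [hsm, htop]
    obtain ⟨i, hi⟩ : ∃ i, i = 1 / (1 - γ) := ⟨_, rfl⟩
    have hiη : i * (1 - γ) = 1 := by rw [hi]; field_simp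
    rw [← hi]
    unfold navBase
    refine le_of_eq ?_
    split_ifs
    · linear_combination -hiη + hD
    · linear_combination -hiη

end Navigation

end MDP

/-! ### The hard navigation MDP -/

namespace MDP

lemma ceil_pos_of_lt {c₁ Q x δ : ℝ} (hc : 0 < c₁) (hQ : 0 < Q) (hx : 0 < x) (hδ : 0 < δ)
    (hδ1 : δ < 1 / 12) : 0 < ⌈c₁ * Q / x * Real.log (1 / 12 / δ)⌉₊ := by
  rw [Nat.ceil_pos]
  have : 0 < Real.log (1 / 12 / δ) := Real.log_pos (by rw [lt_div_iff₀ hδ]; linarith)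
  positivity

lemma card_pairs_ge {S A : Type*} [Fintype S] [Fintype A] (hS : 4 ≤ Fintype.card S)
    (hA : 2 ≤ Fintype.card A) (top : S) (a₀ : A) [Fintype {x : S × A // x.1 ≠ top ∧ x.2 ≠ a₀}] :
    3 * Fintype.card (S × A) ≤ 8 * Fintype.card {x : S × A // x.1 ≠ top ∧ x.2 ≠ a₀} := by
  classical
  have h1 : Fintype.card {x : S × A // x.1 ≠ top ∧ x.2 ≠ a₀}
      = (Fintype.card S - 1) * (Fintype.card A - 1) := by
    rw [Fintype.card_congr (Equiv.subtypeProdEquivProd (p := fun s => s ≠ top)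
      (q := fun a => a ≠ a₀)), Fintype.card_prod, Fintype.card_subtype_compl,
      Fintype.card_subtype_compl]
    simp
  rw [h1, Fintype.card_prod]
  obtain ⟨x, hx⟩ : ∃ x, Fintype.card S = x + 4 := ⟨_, (Nat.sub_add_cancel hS).symm⟩
  obtain ⟨y, hy⟩ : ∃ y, Fintype.card A = y + 2 := ⟨_, (Nat.sub_add_cancel hA).symm⟩
  rw [hx, hy]
  simp only [Nat.add_succ_sub_one]
  nlinarith

set_option maxHeartbeats 1000000 in
-- A pair is good at a history if it claims more than half of the remaining discounted time outside
-- `top`; at most one pair is good at a time. Whenever the chosen pair is not good, the policy errs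
-- in `M₁`. Goodness is defined by counts under `M₀`, hence by the history alone, so it describes
-- the same event under both laws.
theorem exists_hard_navigation {S A : Type*} [Fintype S] [Fintype A] [MeasurableSpace S]
    [DiscreteMeasurableSpace S] {γ ε δ c₁ : ℝ} (hS : 4 ≤ Fintype.card S)
    (hA : 2 ≤ Fintype.card A) (hγ0 : 3 / 4 < γ) (hγ1 : γ < 1) (hε : 0 < ε)
    (hεγ : 8100 * (ε * (1 - γ)) ≤ 1) (hsmall : (3 * Fintype.card S + 2) * (1 - γ) ≤ 6 / 100)
    (hδ : 0 < δ) (hδ1 : δ < 1 / 12) (hc0 : 0 < c₁) (hc : 13122 * 384 * c₁ ≤ 1)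
    (hx1 : 13122 * 384 * (ε ^ 2 * (1 - γ) ^ 3) ≤ 1) :
    ∃ (r : S → ℝ) (s₁ : S) (sp sm : S → A → S),
      ∀ π : Policy S A, ∃ M : MDP S A,
        M.reward = r ∧ M.discount = γ ∧ M.HasNextStates sp sm ∧
        ENNReal.ofReal δ ≤ M.law π s₁
          {ω | ((⌈c₁ * Fintype.card (S × A) / (ε ^ 2 * (1 - γ) ^ 3) *
              Real.log (1 / 12 / δ)⌉₊ : ℕ) : ℕ∞) ≤ (M.errorTimes π ε ω).encard} := by
  classical
  have hγp : 0 < γ := by linarith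
  have hη : 0 < 1 - γ := by linarith
  set x := ε ^ 2 * (1 - γ) ^ 3 with hx
  have hx0 : 0 < x := by positivity
  set Q : ℝ := ((Fintype.card (S × A) : ℕ) : ℝ) with hQ
  have hQ1 : 1 ≤ Q := by
    have : 1 ≤ Fintype.card (S × A) := by rw [Fintype.card_prod]; nlinarith
    rw [hQ]; exact_mod_cast this
  set N := ⌈c₁ * Q / x * Real.log (1 / 12 / δ)⌉₊ with hN
  have hN0 : 0 < N := ceil_pos_of_lt hc0 (by linarith) hx0 hδ hδ1
  obtain ⟨top, w₀, nx, hw₀, hnx, hdist⟩ := exists_cyclic_navigation S (by omega)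
  have hAne : Nonempty A := Fintype.card_pos_iff.1 (by omega)
  let a₀ : A := Classical.arbitrary A
  set Δ := 81 * (ε * (1 - γ)) with hΔ
  have hΔ0 : 0 < Δ := by positivity
  have hΔ1 : Δ ≤ 1 / 100 := by linarith
  obtain ⟨D, hD⟩ : ∃ D : ℝ, D * (1 - γ) * (1 + 2 * γ) = 1 :=
    ⟨1 / ((1 - γ) * (1 + 2 * γ)), by field_simp⟩
  have hη4 : 1 - γ < 1 / 4 := by linarith
  have hPmem : ∀ (c : S) (b : A) (Δ' : ℝ), 0 ≤ Δ' → Δ' ≤ 1 → ∀ s a,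
      navProb top γ c b Δ' s a ∈ Set.Icc (0 : ℝ) 1 := by
    intro c b Δ' h1 h2 s a
    unfold navProb
    split_ifs
    · exact ⟨hγp.le, hγ1.le⟩
    · exact ⟨by positivity, by nlinarith⟩
    · exact ⟨hη.le, by linarith⟩
  let r : S → ℝ := fun s => if s = top then 1 else 0
  have hr : ∀ s, r s ∈ Set.Icc (0 : ℝ) 1 := fun s => by
    simp only [r]; split_ifs <;> simp
  refine ⟨r, w₀, fun _ _ => top, navNext top w₀ nx a₀, fun π => ?_⟩
  -- With perturbation 0 the state and the action supplied to `navProb` are immaterial.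
  obtain ⟨M₀, -, hd0, -, h₀⟩ := exists_isTwoPoint (fun _ _ => top) (navNext top w₀ nx a₀)
    (navProb top γ top a₀ 0) (hPmem top a₀ 0 le_rfl zero_le_one) r hr γ ⟨hγp, hγ1⟩
  rw [navProb_zero] at h₀
  let ι := {x : S × A // x.1 ≠ top ∧ x.2 ≠ a₀}
  have hJ : 3 * Fintype.card (S × A) ≤ 8 * Fintype.card ι := card_pairs_ge hS hA top a₀
  set J : ℝ := ((Fintype.card ι : ℕ) : ℝ) with hJdef
  have hJ' : 3 * Q ≤ 8 * J := by rw [hQ, hJdef]; exact_mod_cast hJ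
  have hJ3 : 3 ≤ J := by
    have h8 : 8 ≤ Fintype.card (S × A) := by rw [Fintype.card_prod]; nlinarith
    have : 3 ≤ Fintype.card ι := by omega
    rw [hJdef]; exact_mod_cast this
  have hιne : Nonempty ι := Fintype.card_pos_iff.1 (by
    have : (0 : ℝ) < Fintype.card ι := by rw [← hJdef]; linarith
    exact_mod_cast this)
  let f : ι → List S → S → ℝ := fun j h s => if s = j.1.1 ∧ π (h ++ [s]) = j.1.2 then 1 else 0
  have hf : ∀ j h s, f j h s ∈ Set.Icc (0 : ℝ) 1 := fun j h s => by
    simp only [f]; split_ifs <;> simp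
  let G : ι → List S → S → ℝ := fun j => M₀.discVal π (f j)
  have hG : ∀ j h s, G j h s ∈ Set.Icc (0 : ℝ) (1 / (1 - γ)) := fun j h s => by
    rw [← hd0]; exact M₀.discVal_mem_Icc π (hf j) h s
  have hsum : ∀ h s, ∑ j, G j h s ≤ 1 / (1 - γ) - navBase top γ D s :=
    sum_discVal_le_navigation hγ1 hD hw₀ hnx h₀ hd0 π
  have hDpos : 0 < D := by
    by_contra! hneg
    nlinarith [mul_pos hη (by linarith : 0 < 1 + 2 * γ)]
  have hBle : ∀ s, navBase top γ D s ≤ (1 + γ) * D := fun s => by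
    unfold navBase; split_ifs <;> nlinarith
  have hWpos : ∀ s, 0 < 1 / (1 - γ) - navBase top γ D s := fun s => by
    have h1 : (1 + γ) * D < 1 / (1 - γ) := by
      rw [lt_div_iff₀ hη]; nlinarith [mul_pos hDpos hη]
    linarith [hBle s]
  let good : ι → List S → Prop := fun j l =>
    ∃ s, l.getLast? = some s ∧ (1 / (1 - γ) - navBase top γ D s) / 2 < G j l.dropLast s
  let pair : ι → List S → Prop := fun j l => l.getLast? = some j.1.1 ∧ π l = j.1.2
  set T := 4 * N with hTdef
  have hT0 : (0 : ℝ) < T := by rw [hTdef]; exact_mod_cast Nat.mul_pos (by norm_num) hN0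
  -- If φ j < 1, the pair is good at fewer than 3T/4 times, which leaves more than T/4 = N errors,
  -- and is used fewer than 36T/J times. The sum over j is at most 4/3 + J/36, and its average at
  -- most 4/9 + 1/36 < 1/2 because J ≥ 3.
  let φ : ι → List S → ℝ := fun j l => 4 / (3 * T) * listCount (good j) l
    + J / (36 * T) * listCount (pair j) l
  have count_le : ∀ (p : ι → List S → Prop), (∀ l i j, p i l → p j l → i = j) → ∀ ω : ℕ → S,
      ∑ j, (listCount (p j) (pastStates ω T) : ℝ) ≤ T := by
    intro p hp ω
    have h1 : ∑ j, listCount (p j) (pastStates ω T) ≤ T := by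
      simp only [listCount_pastStates, Finset.card_filter]
      rw [Finset.sum_comm]
      calc _ ≤ ∑ _t ∈ Finset.range T, 1 := Finset.sum_le_sum fun t _ => by
            rw [← Finset.card_filter]
            refine Finset.card_le_one.2 fun i hi j hj => ?_
            rw [Finset.mem_filter] at hi hj
            exact hp _ i j hi.2 hj.2
        _ = T := by simp
    exact_mod_cast h1
  have hgood : ∀ l i j, good i l → good j l → i = j := by
    rintro l i j ⟨s, hs, hi⟩ ⟨s', hs', hj⟩
    obtain rfl : s = s' := Option.some.inj (hs.symm.trans hs')
    by_contra hij
    have h1 : G i l.dropLast s + G j l.dropLast s ≤ ∑ k, G k l.dropLast s := by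
      rw [← Finset.sum_pair (f := fun k => G k l.dropLast s) hij]
      exact Finset.sum_le_sum_of_subset_of_nonneg (Finset.subset_univ _) fun k _ _ => (hG k _ _).1
    linarith [hsum l.dropLast s]
  have hpair : ∀ l i j, pair i l → pair j l → i = j := fun l i j hi hj =>
    Subtype.ext (Prod.ext (Option.some.inj (hi.1.symm.trans hj.1)) (hi.2.symm.trans hj.2))
  obtain ⟨j, hj⟩ := exists_measure_one_le_le (M₀.law π w₀) (fun j ω => φ j (pastStates ω T))
    (fun j => measurable_pastStates (φ j) T) (fun j ω => by positivity) (K := 4 / 3 + J / 36)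
    (Filter.Eventually.of_forall fun ω => by
      simp only [φ]
      rw [Finset.sum_add_distrib, ← Finset.mul_sum, ← Finset.mul_sum]
      calc _ ≤ 4 / (3 * T) * (T : ℝ) + J / (36 * T) * T :=
            add_le_add (mul_le_mul_of_nonneg_left (count_le good hgood ω) (by positivity))
              (mul_le_mul_of_nonneg_left (count_le pair hpair ω) (by positivity))
        _ = _ := by field_simp)
  obtain ⟨c, hcdef⟩ : ∃ c, c = j.1.1 := ⟨_, rfl⟩
  obtain ⟨b, hbdef⟩ : ∃ b, b = j.1.2 := ⟨_, rfl⟩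
  have hct : c ≠ top := hcdef ▸ j.2.1
  have hba : b ≠ a₀ := hbdef ▸ j.2.2
  have hP₁ := hPmem c b Δ hΔ0.le (by linarith)
  obtain ⟨M₁, hr1, hd1, hn1, h₁⟩ := exists_isTwoPoint (fun _ _ => top) (navNext top w₀ nx a₀)
    (navProb top γ c b Δ) hP₁ r hr γ ⟨hγp, hγ1⟩
  refine ⟨M₁, hr1, hd1, hn1, ?_⟩
  have h₀' : M₀.IsTwoPoint (fun _ _ => top) (navNext top w₀ nx a₀) (navProb top γ c b 0) := by
    rw [navProb_zero]; exact h₀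
  obtain ⟨d, hdc, hdm, hdnx⟩ := hdist c hct
  have hp0 : navProb top γ c b 0 c b = 1 - γ := by simp [navProb, hct]
  have hp1 : navProb top γ c b Δ c b = (1 - γ) * (1 + Δ) := by simp [navProb, hct]
  have hp1lt : (1 - γ) * (1 + Δ) ≤ 1 / 2 := by nlinarith
  have hp1pos : 0 < (1 - γ) * (1 + Δ) := by positivity
  refine h₀'.le_law_errorTimes h₁ hP₁ c b (fun s a hsa => ?_) (by rw [hp1]; exact hp1pos)
    (by rw [hp1]; linarith) (R := 1 + 2 * (1 - γ) * Δ ^ 2) (by nlinarith [sq_nonneg Δ]) ?_ π w₀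
    ⌊36 * T / J⌋₊ T (Nat.mul_pos (by norm_num) hN0) (B := {l | φ j l < 1}) (fun l hl => ?_) ?_ ?_
    (Filter.Eventually.of_forall fun ω hω => ?_)
  · have : ¬ (s = c ∧ a = b) := fun h => hsa h.1 h.2
    simp [navProb, this]
  · rw [hp0, hp1]
    -- The excess of the second moment over 1 carries the small factor 1 - γ, which supplies the
    -- third power in the bound.
    have e : (1 - γ) ^ 2 / ((1 - γ) * (1 + Δ)) + (1 - (1 - γ)) ^ 2 / (1 - (1 - γ) * (1 + Δ))
        = 1 + (1 - γ) * Δ ^ 2 / ((1 + Δ) * (1 - (1 - γ) * (1 + Δ))) := by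
      have h1 : 1 - (1 - γ) * (1 + Δ) ≠ 0 := by linarith
      have h2 : 1 + Δ ≠ 0 := by linarith
      field_simp
      ring
    rw [e, add_le_add_iff_left, div_le_iff₀ (mul_pos (by linarith) (by linarith))]
    have h3 : 1 / 2 ≤ (1 + Δ) * (1 - (1 - γ) * (1 + Δ)) := by nlinarith
    have h4 : 0 ≤ (1 - γ) * Δ ^ 2 := by positivity
    nlinarith
  · have hl' : φ j l < 1 := hl
    have h1 : J / (36 * T) * listCount (pair j) l ≤ 1 := by
      have : 0 ≤ 4 / (3 * (T : ℝ)) * listCount (good j) l := by positivity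
      simp only [φ] at hl'
      linarith
    rw [div_mul_eq_mul_div, div_le_one (by positivity)] at h1
    have e : (fun l => l.getLast? = some c ∧ π l = b) = pair j := by rw [hcdef, hbdef]
    rw [e]
    refine Nat.le_floor ?_
    rw [le_div_iff₀ (by linarith)]
    linarith
  · have e : {ω : ℕ → S | pastStates ω T ∈ {l | φ j l < 1}}ᶜ
        = {ω | 1 ≤ φ j (pastStates ω T)} := by
      ext ω; simp
    rw [e]
    refine hj.trans (ENNReal.ofReal_le_ofReal ?_)
    rw [← hJdef, div_le_iff₀ (by linarith)]
    linarith
  · refine le_quarter_div_pow (u := 2 * (1 - γ) * Δ ^ 2) hQ1 hx0 (by norm_num) hx1 hc hc0 hδ hδ1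
      (by nlinarith [sq_nonneg Δ]) le_rfl ?_
    rw [← hN]
    have hu : 2 * (1 - γ) * Δ ^ 2 = 13122 * x := by rw [hΔ, hx]; ring
    -- 384 = 36 · 4 · 8/3, from T = 4N and 3Q ≤ 8J.
    have hfl : (⌊36 * T / J⌋₊ : ℝ) ≤ 384 * N / Q := by
      refine (Nat.floor_le (by positivity)).trans ?_
      rw [hTdef, div_le_div_iff₀ (by linarith) (by linarith)]
      push_cast
      have : (0 : ℝ) ≤ N := Nat.cast_nonneg N
      nlinarith
    rw [hu]
    calc _ ≤ 384 * N / Q * (13122 * x) := mul_le_mul_of_nonneg_right hfl (by positivity)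
      _ = _ := by ring
  · have hω' : φ j (pastStates ω T) < 1 := hω
    have h1 : 4 / (3 * (T : ℝ)) * listCount (good j) (pastStates ω T) < 1 := by
      have : 0 ≤ J / (36 * T) * listCount (pair j) (pastStates ω T) := by positivity
      simp only [φ] at hω'
      linarith
    rw [div_mul_eq_mul_div, div_lt_one (by positivity)] at h1
    have h2 : 4 * listCount (good j) (pastStates ω T) < 3 * T := by exact_mod_cast h1
    rw [listCount_pastStates] at h2
    have h2' : 4 * ((Finset.range T).filter fun t => good j (pastStates ω (t + 1))).card < 3 * T := by
      convert h2
    have h3 := Finset.card_filter_add_card_filter_not (s := Finset.range T)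
      (fun t => good j (pastStates ω (t + 1)))
    rw [Finset.card_range] at h3
    refine le_encard_errorTimes
      ((Finset.range T).filter fun t => ¬ good j (pastStates ω (t + 1))) (by omega) fun t ht => ?_
    have hng := (Finset.mem_filter.1 ht).2
    have hle : G j (pastStates ω t) (ω t) ≤ (1 / (1 - γ) - navBase top γ D (ω t)) / 2 := by
      by_contra! hlt
      exact hng ⟨ω t, by simp [pastStates_succ], by simpa [pastStates_succ] using hlt⟩
    refine lt_sub_of_navigation (H := navCost top (Fintype.card S) d (ω t)) (i := 1 / (1 - γ)) hγ0
      hγ1 hε (by field_simp) hD hΔ hΔ1 rfl (hBle _) ?_ hle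
      (value_le_navigation hγp hγ1 hD hΔ0.le (by linarith) hw₀ hnx hct h₀' h₁ hr1 hd1 π
        (fun h s => (hG j h s).1) (fun h s => ?_) (fun h s => ?_) _ _)
      (le_optValue_navigation hγp hγ1 hD hΔ0.le (by linarith) hw₀ hnx hct hba hdc hdm hdnx h₁
        hr1 hd1 _)
    · have h4 : navCost top (Fintype.card S) d (ω t) ≤ 3 * Fintype.card S + 2 := by
        have : (d (ω t) : ℝ) ≤ Fintype.card S := by exact_mod_cast hdm _
        unfold navCost
        split_ifs <;> linarith
      nlinarith
    · have := (hG j h s).2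
      rw [le_div_iff₀ hη] at this
      linarith
    · have := M₀.discVal_eq π (hf j) h s
      rw [hd0] at this
      rw [hcdef, hbdef]
      exact this

end MDP

/-! ### Clock systems: existence and combinatorics of the tracks -/

/-- An arrangement of `n` groups of states on a clock with `n * ℓ` positions, `ℓ` for each group: at
the first position of a group there is a single state on the track `0`, at the others there is one
state on each of the tracks `-1`, `0`, `1`. Spare states are copies of states at the last position
of a group. -/
structure ClockSystem (S : Type*) (ℓ n : ℕ) where
  clk : S → ℕ
  trk : S → ℤ
  state : ℕ → ℤ → S
  clk_lt : ∀ s, clk s < n * ℓ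
  abs_trk_le : ∀ s, |trk s| ≤ 1
  trk_eq_zero : ∀ s, clk s % ℓ = 0 → trk s = 0
  clk_state : ∀ t τ, |τ| ≤ 1 → clk (state t τ) = t % (n * ℓ)
  trk_state : ∀ t τ, |τ| ≤ 1 → trk (state t τ) = if t % ℓ = 0 then 0 else τ
  state_eq : ∀ s, clk s % ℓ + 1 ≠ ℓ → state (clk s) (trk s) = s

lemma nonempty_clockSystem (S : Type*) [Fintype S] {ℓ n : ℕ} (hℓ : 2 ≤ ℓ) (hn : 1 ≤ n)
    (hcard : n * (3 * ℓ - 2) ≤ Fintype.card S) : Nonempty (ClockSystem S ℓ n) := by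
  obtain ⟨w, hw⟩ : ∃ w, w = 3 * ℓ - 2 := ⟨_, rfl⟩
  rw [← hw] at hcard
  have hw0 : 0 < w := by omega
  have hnl : 0 < n * ℓ := Nat.mul_pos hn (by omega)
  have hcard0 : 0 < Fintype.card S := lt_of_lt_of_le (Nat.mul_pos hn hw0) hcard
  let e : S ≃ Fin (Fintype.card S) := Fintype.equivFin S
  -- The states of a group are numbered consecutively: residue 0 modulo `w` is the first position,
  -- and 3p-2, 3p-1, 3p are the tracks -1, 0, 1 at position p. Indices from `n * w` on are spare.
  let clk : ℕ → ℕ := fun i => if i < n * w then (i / w) * ℓ + (i % w + 2) / 3 else ℓ - 1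
  let trk : ℕ → ℤ := fun i => if i < n * w ∧ i % w ≠ 0 then (((i % w + 2) % 3 : ℕ) : ℤ) - 1 else 0
  let idx : ℕ → ℤ → ℕ := fun t τ => (t % (n * ℓ) / ℓ) * w
    + if t % ℓ = 0 then 0 else (3 * ((t % ℓ : ℕ) : ℤ) - 1 + τ).toNat
  have hpos : ∀ i, i < n * w → (i % w + 2) / 3 < ℓ := fun i _ => by
    have := Nat.mod_lt i hw0
    omega
  have hdiv : ∀ i, i < n * w → i / w < n := fun i hi => Nat.div_lt_of_lt_mul (by rwa [mul_comm])
  have hclk : ∀ i, clk i < n * ℓ := fun i => by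
    simp only [clk]
    split_ifs with h
    · have h1 := hpos i h
      have h2 := Nat.mul_le_mul_right ℓ (Nat.succ_le_of_lt (hdiv i h))
      rw [Nat.succ_mul] at h2
      omega
    · have := Nat.mul_le_mul_right ℓ hn
      omega
  have hclkmod : ∀ i, clk i % ℓ = if i < n * w then (i % w + 2) / 3 else ℓ - 1 := fun i => by
    simp only [clk]
    split_ifs with h
    · rw [mul_comm, Nat.mul_add_mod, Nat.mod_eq_of_lt (hpos i h)]
    · exact Nat.mod_eq_of_lt (by omega)
  have hg : ∀ t, t % (n * ℓ) / ℓ < n := fun t =>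
    Nat.div_lt_of_lt_mul (by rw [mul_comm ℓ n]; exact Nat.mod_lt _ hnl)
  have hq : ∀ t τ, |τ| ≤ 1 → (if t % ℓ = 0 then 0 else (3 * ((t % ℓ : ℕ) : ℤ) - 1 + τ).toNat) < w := by
    intro t τ hτ
    rw [abs_le] at hτ
    have := Nat.mod_lt t (by omega : 0 < ℓ)
    split_ifs
    · exact hw0
    · omega
  have hidx : ∀ t τ, |τ| ≤ 1 → idx t τ < n * w := fun t τ hτ => by
    have h1 := hq t τ hτ
    have h2 := Nat.mul_le_mul_right w (Nat.succ_le_of_lt (hg t))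
    rw [Nat.succ_mul] at h2
    simp only [idx]
    omega
  have hidxdiv : ∀ t τ, |τ| ≤ 1 → idx t τ / w = t % (n * ℓ) / ℓ := fun t τ hτ => by
    simp only [idx]
    rw [mul_comm, Nat.mul_add_div hw0, Nat.div_eq_of_lt (hq t τ hτ), add_zero]
  have hidxmod : ∀ t τ, |τ| ≤ 1 →
      idx t τ % w = if t % ℓ = 0 then 0 else (3 * ((t % ℓ : ℕ) : ℤ) - 1 + τ).toNat := fun t τ hτ => by
    simp only [idx]
    rw [mul_comm, Nat.mul_add_mod, Nat.mod_eq_of_lt (hq t τ hτ)]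
  have hmm : ∀ t, t % (n * ℓ) % ℓ = t % ℓ := fun t => Nat.mod_mul_left_mod t n ℓ
  let state : ℕ → ℤ → S := fun t τ => if h : idx t τ < Fintype.card S then e.symm ⟨idx t τ, h⟩
    else e.symm ⟨0, hcard0⟩
  have hstate : ∀ t τ, |τ| ≤ 1 → (e (state t τ)).val = idx t τ := fun t τ hτ => by
    have : idx t τ < Fintype.card S := (hidx t τ hτ).trans_le hcard
    simp [state, this]
  refine ⟨⟨fun s => clk (e s), fun s => trk (e s), state, fun s => hclk _, fun s => ?_,
    fun s hs => ?_, fun t τ hτ => ?_, fun t τ hτ => ?_, fun s hs => ?_⟩⟩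
  · simp only [trk]
    split_ifs
    · rw [abs_le]; omega
    · simp
  · simp only [hclkmod] at hs
    simp only [trk]
    split_ifs at hs ⊢ <;> first | rfl | omega
  · simp only [hstate t τ hτ, clk, if_pos (hidx t τ hτ), hidxdiv t τ hτ, hidxmod t τ hτ]
    have h2 : ((if t % ℓ = 0 then 0 else (3 * ((t % ℓ : ℕ) : ℤ) - 1 + τ).toNat) + 2) / 3 = t % ℓ := by
      rw [abs_le] at hτ
      split_ifs <;> omega
    rw [h2, ← hmm t]
    exact Nat.div_add_mod' _ _
  · simp only [hstate t τ hτ, trk, hidx t τ hτ, hidxmod t τ hτ, true_and]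
    rw [abs_le] at hτ
    by_cases h : t % ℓ = 0
    · simp [h]
    · simp only [h, if_false]
      split_ifs <;> omega
  · have hlt : (e s).val < n * w := by
      by_contra hge
      simp only [hclkmod, if_neg hge] at hs
      omega
    have hτ : |trk (e s)| ≤ 1 := by
      simp only [trk]
      split_ifs
      · rw [abs_le]; omega
      · simp
    refine e.injective (Fin.ext ?_)
    rw [hstate _ _ hτ]
    simp only [idx, hclkmod, if_pos hlt, Nat.mod_eq_of_lt (hclk _)]
    have h1 : clk (e s) / ℓ = (e s).val / w := by
      simp only [clk, if_pos hlt]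
      rw [mul_comm, Nat.mul_add_div (by omega), Nat.div_eq_of_lt (hpos _ hlt), add_zero]
    have h2 : (if ((e s).val % w + 2) / 3 = 0 then 0
        else (3 * ((((e s).val % w + 2) / 3 : ℕ) : ℤ) - 1 + trk (e s)).toNat) = (e s).val % w := by
      simp only [trk, hlt, true_and]
      split_ifs <;> omega
    rw [h1, h2]
    exact Nat.div_add_mod' _ _

/-- The discounted gain of the track `1` over the track `0` in `k` steps. -/
noncomputable def trackGain (γ : ℝ) (k : ℕ) : ℝ := (1 - γ ^ k) / (2 * (1 - γ))

lemma trackGain_succ {γ : ℝ} (hγ1 : γ < 1) (k : ℕ) :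
    trackGain γ (k + 1) = 1 / 2 + γ * trackGain γ k := by
  have : 1 - γ ≠ 0 := by linarith
  unfold trackGain
  field_simp
  ring

lemma trackGain_mono {γ : ℝ} (hγ0 : 0 < γ) (hγ1 : γ < 1) {j k : ℕ} (h : j ≤ k) :
    trackGain γ j ≤ trackGain γ k := by
  have h1 := pow_le_pow_of_le_one hγ0.le hγ1.le h
  have : 0 < 1 - γ := by linarith
  unfold trackGain
  gcongr

lemma trackGain_nonneg {γ : ℝ} (hγ0 : 0 < γ) (hγ1 : γ < 1) (k : ℕ) : 0 ≤ trackGain γ k := by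
  have h := trackGain_mono hγ0 hγ1 (Nat.zero_le k)
  simpa [trackGain] using h

namespace ClockSystem

variable {S A : Type*} {ℓ n : ℕ} (C : ClockSystem S ℓ n)

/-- The states on the track `0` in which an action can leave this track. -/
def Arm (e : ℕ) (s : S) : Prop := C.trk s = 0 ∧ e ≤ C.clk s % ℓ + 1 ∧ C.clk s % ℓ + 2 ≤ 2 * e

/-- In an arm state every action but `a₀` leads to the track `τ`; otherwise the track is kept. -/
noncomputable def next (e : ℕ) (a₀ : A) (τ : ℤ) (s : S) (a : A) : S :=
  open Classical in
  if C.Arm e s ∧ a ≠ a₀ then C.state (C.clk s + 1) τ else C.state (C.clk s + 1) (C.trk s)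

/-- The value of a state if the track `0` is never left. -/
noncomputable def base (γ : ℝ) (s : S) : ℝ :=
  1 / (2 * (1 - γ)) + C.trk s * trackGain γ (ℓ - C.clk s % ℓ)

/-- The probability `θ` of a reward track for the action `b` in the state `s₀`, and `q` for all
other pairs. -/
noncomputable def prob (s₀ : S) (b : A) (θ q : ℝ) (s : S) (a : A) : ℝ :=
  open Classical in if s = s₀ ∧ a = b then θ else q

/-- The number of steps until the clock shows `c` on the track `0`. -/
noncomputable def rem (c : ℕ) (s : S) : ℕ :=
  open Classical in
  if C.clk s ≤ c ∧ (C.trk s = 0 ∨ C.clk s < c - c % ℓ) then c - C.clk s else c + n * ℓ - C.clk s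

lemma clk_state_mod {t : ℕ} {τ : ℤ} (hτ : |τ| ≤ 1) : C.clk (C.state t τ) % ℓ = t % ℓ := by
  rw [C.clk_state t τ hτ, Nat.mod_mul_left_mod]

lemma succ_mod {ℓ t : ℕ} (hℓ : 2 ≤ ℓ) :
    (t % ℓ + 1 = ℓ ∧ (t + 1) % ℓ = 0) ∨ (t % ℓ + 1 < ℓ ∧ (t + 1) % ℓ = t % ℓ + 1) := by
  have h1 := Nat.mod_lt t (by omega : 0 < ℓ)
  rcases Nat.lt_or_ge (t % ℓ + 1) ℓ with h | h
  · right
    refine ⟨h, ?_⟩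
    rw [Nat.add_mod, Nat.mod_eq_of_lt (by omega : 1 < ℓ), Nat.mod_eq_of_lt h]
  · left
    have h2 : t % ℓ + 1 = ℓ := by omega
    refine ⟨h2, ?_⟩
    rw [Nat.add_mod, Nat.mod_eq_of_lt (by omega : 1 < ℓ), h2, Nat.mod_self]

lemma base_state (hℓ : 2 ≤ ℓ) (γ : ℝ) (t : ℕ) {τ : ℤ} (hτ : |τ| ≤ 1) :
    C.base γ (C.state (t + 1) τ) = 1 / (2 * (1 - γ)) + τ * trackGain γ (ℓ - t % ℓ - 1) := by
  unfold base
  rw [C.clk_state_mod hτ, C.trk_state _ _ hτ]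
  rcases succ_mod (t := t) hℓ with ⟨h1, h2⟩ | ⟨h1, h2⟩
  · have h3 : ℓ - t % ℓ - 1 = 0 := by omega
    simp [h2, h3, trackGain]
  · rw [h2, if_neg (by omega)]
    rfl

open Classical in
-- `base` solves the Bellman equation as long as the track is kept. Leaving the track 0 for the
-- tracks 1 and -1 with probabilities θ and 1 - θ changes it by (2θ - 1) times the gain over the
-- rest of the group, which is the entire effect of an action.
lemma reward_add_base (hℓ : 2 ≤ ℓ) {γ : ℝ} (hγ1 : γ < 1) (e : ℕ) (a₀ : A) (θ : ℝ) (s : S) (a : A) :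
    (1 + (C.trk s : ℝ)) / 2 + γ * (θ * C.base γ (C.next e a₀ 1 s a)
      + (1 - θ) * C.base γ (C.next e a₀ (-1) s a))
      = C.base γ s + if C.Arm e s ∧ a ≠ a₀ then
        γ * (2 * θ - 1) * trackGain γ (ℓ - C.clk s % ℓ - 1) else 0 := by
  have hη : 1 - γ ≠ 0 := by linarith
  have hi : 1 / (2 * (1 - γ)) = 1 / 2 + γ * (1 / (2 * (1 - γ))) := by field_simp; ring
  have hk : ℓ - C.clk s % ℓ = (ℓ - C.clk s % ℓ - 1) + 1 := by
    have := Nat.mod_lt (C.clk s) (by omega : 0 < ℓ)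
    omega
  have hb : C.base γ s = 1 / (2 * (1 - γ))
      + C.trk s * (1 / 2 + γ * trackGain γ (ℓ - C.clk s % ℓ - 1)) := by
    rw [← trackGain_succ hγ1, ← hk]; rfl
  unfold next
  split_ifs with h
  · rw [C.base_state hℓ γ _ (by norm_num), C.base_state hℓ γ _ (by norm_num), hb, h.1.1]
    push_cast
    linear_combination -hi
  · rw [C.base_state hℓ γ _ (C.abs_trk_le s), hb]
    linear_combination -hi

/-- The number of steps to the clock position `c` on the track `0` decreases by at most one in a
step. -/
lemma rem_le_rem_state (hℓ : 2 ≤ ℓ) {c : ℕ} (hc : c < n * ℓ) (hcℓ : c % ℓ + 1 < ℓ) (s : S)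
    {τ : ℤ} (hτ : |τ| ≤ 1) (hs : τ = C.trk s ∨ C.trk s = 0) :
    C.rem c s ≤ C.rem c (C.state (C.clk s + 1) τ) + 1
      ∧ (τ = C.trk s → ¬ (C.clk s = c ∧ C.trk s = 0) →
          C.rem c s = C.rem c (C.state (C.clk s + 1) τ) + 1)
      ∧ (C.trk s = 0 → C.clk s ≤ c → c - c % ℓ ≤ C.clk s →
          (C.clk s = c ∨ τ ≠ 0 ∧ C.clk s % ℓ + 1 ≠ ℓ) →
            C.rem c (C.state (C.clk s + 1) τ) + 1 = n * ℓ + C.rem c s) := by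
  have hlt := C.clk_lt s
  have h0 := C.trk_eq_zero s
  have hclk : C.clk (C.state (C.clk s + 1) τ) = if C.clk s + 1 = n * ℓ then 0 else C.clk s + 1 := by
    rw [C.clk_state _ _ hτ]
    split_ifs with h
    · rw [h, Nat.mod_self]
    · exact Nat.mod_eq_of_lt (by omega)
  have htrk := C.trk_state (C.clk s + 1) τ hτ
  have hstart : ∀ x, c - c % ℓ ≤ x → x < c - c % ℓ + ℓ → x % ℓ = x - (c - c % ℓ) := by
    intro x h1 h2
    obtain ⟨y, rfl⟩ := Nat.exists_eq_add_of_le h1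
    have e : c - c % ℓ = ℓ * (c / ℓ) := by
      have := Nat.div_add_mod c ℓ
      omega
    rw [e, Nat.mul_add_mod, Nat.mod_eq_of_lt (by omega)]
    omega
  have hcle := Nat.mod_le c ℓ
  have hcn : c + 1 < n * ℓ := by
    rcases Nat.lt_or_ge (c + 1) (n * ℓ) with h | h
    · exact h
    · exfalso
      have h1 : c + 1 = n * ℓ := by omega
      rcases succ_mod (t := c) hℓ with ⟨h2, _⟩ | ⟨_, h3⟩
      · omega
      · rw [h1, Nat.mul_mod_left] at h3; omega
  have hs1 := hstart (C.clk s)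
  have hs2 := hstart (C.clk s + 1)
  have hsucc := succ_mod (t := C.clk s) hℓ
  have hwrap : n * ℓ % ℓ = 0 := Nat.mul_mod_left n ℓ
  unfold rem
  rw [hclk, htrk]
  by_cases hL : C.clk s + 1 = n * ℓ
  · rw [if_pos hL, hL, hwrap]
    rw [hL, hwrap] at hsucc hs2
    simp only [if_true, true_or, and_true, Nat.zero_le]
    refine ⟨?_, fun _ _ => ?_, fun _ _ _ _ => ?_⟩ <;> split_ifs <;> omega
  · rw [if_neg hL]
    refine ⟨?_, fun _ _ => ?_, fun _ _ _ _ => ?_⟩ <;> split_ifs <;> omega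

end ClockSystem

/-! ### Visits to a clock position, and values on the ring -/

namespace ClockSystem

variable {S A : Type*} {ℓ n : ℕ} (C : ClockSystem S ℓ n) {e : ℕ} {a₀ b : A} {s₀ : S} {γ Δ : ℝ}

lemma clk_next (a₀ : A) {τ : ℤ} (hτ : |τ| ≤ 1) (s : S) (a : A) :
    C.clk (C.next e a₀ τ s a) = (C.clk s + 1) % (n * ℓ) := by
  unfold next
  split_ifs
  · exact C.clk_state _ _ hτ
  · exact C.clk_state _ _ (C.abs_trk_le s)

lemma next_of_arm {s : S} {a : A} (h : C.Arm e s ∧ a ≠ a₀) (τ : ℤ) :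
    C.next e a₀ τ s a = C.state (C.clk s + 1) τ := if_pos h

lemma next_of_not_arm {s : S} {a : A} (h : ¬ (C.Arm e s ∧ a ≠ a₀)) (τ : ℤ) :
    C.next e a₀ τ s a = C.state (C.clk s + 1) (C.trk s) := if_neg h

lemma eq_state_of_arm (hℓe : ℓ + 1 = 3 * e) {s : S} (hs : C.trk s = 0)
    (h2 : C.clk s % ℓ + 2 ≤ 2 * e) : s = C.state (C.clk s) 0 := by
  have := C.state_eq s (by omega)
  rw [hs] at this
  exact this.symm

/-- Spare states sit at the last position of a group, where there are no arms, so an arm state is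
determined by its clock position. -/
lemma eq_of_arm (hℓe : ℓ + 1 = 3 * e) {s t : S} (hs : C.Arm e s) (ht : C.trk t = 0)
    (hst : C.clk t = C.clk s) : t = s := by
  rw [C.eq_state_of_arm hℓe hs.1 hs.2.2, C.eq_state_of_arm hℓe ht (hst ▸ hs.2.2), hst]

/-- The discounted number of visits to the clock position `c` on the track `0` by a policy that
never leaves this track at another position. -/
noncomputable def visits (γ : ℝ) (c : ℕ) (s : S) : ℝ := 1 / (1 - γ ^ (n * ℓ)) * γ ^ C.rem c s

lemma visits_nonneg (hγ0 : 0 < γ) (hγ1 : γ < 1) (c : ℕ) (s : S) : 0 ≤ C.visits γ c s := by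
  have h1 := pow_le_one₀ hγ0.le hγ1.le (n := n * ℓ)
  have h2 : 0 ≤ 1 - γ ^ (n * ℓ) := by linarith
  unfold visits
  positivity

lemma visits_eq {c c' : ℕ} {s t : S} {k : ℕ} (h : C.rem c s = C.rem c' t + k) :
    C.visits γ c s = γ ^ k * C.visits γ c' t := by
  unfold visits
  rw [h, pow_add]
  ring

/-- The geometric series: a visit now, and the next one after exactly one revolution. -/
lemma one_add_visits (hn : 0 < n * ℓ) (hγ0 : 0 < γ) (hγ1 : γ < 1) {c c' : ℕ} {s t : S}
    (hs : C.rem c s = 0) (ht : C.rem c' t + 1 = n * ℓ) :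
    C.visits γ c s = 1 + γ * C.visits γ c' t := by
  have h1 := pow_lt_one₀ hγ0.le hγ1 hn.ne'
  have h2 : 1 - γ ^ (n * ℓ) ≠ 0 := by linarith
  have h3 : γ * γ ^ C.rem c' t = γ ^ (n * ℓ) := by rw [← ht, pow_succ]; ring
  unfold visits
  rw [hs]
  field_simp
  linear_combination -h3

lemma rem_arm {s : S} (hs : C.trk s = 0) : C.rem (C.clk s) s = 0 := by
  simp [rem, hs]

lemma clk_arm_mod (hℓe : ℓ + 1 = 3 * e) (hs₀ : C.Arm e s₀) :
    C.clk s₀ % ℓ + 1 < ℓ := by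
  have := hs₀.2.2
  omega

lemma rem_next_arm (hℓe : ℓ + 1 = 3 * e) (hs₀ : C.Arm e s₀) {τ : ℤ} (hτ : |τ| ≤ 1) :
    C.rem (C.clk s₀) (C.state (C.clk s₀ + 1) τ) + 1 = n * ℓ := by
  have h := (C.rem_le_rem_state (by omega) (C.clk_lt s₀) (C.clk_arm_mod hℓe hs₀) s₀ hτ
    (Or.inr hs₀.1)).2.2 hs₀.1 le_rfl (Nat.sub_le _ _) (Or.inl rfl)
  rwa [C.rem_arm hs₀.1, add_zero] at h

lemma visits_next_le (hℓe : ℓ + 1 = 3 * e) (hγ0 : 0 < γ) (hγ1 : γ < 1)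
    (hs₀ : C.Arm e s₀) (a₀ : A) {τ : ℤ} (hτ : |τ| ≤ 1) (s : S) (a : A) :
    γ * C.visits γ (C.clk s₀) (C.next e a₀ τ s a) ≤ C.visits γ (C.clk s₀) s := by
  have key : C.rem (C.clk s₀) s ≤ C.rem (C.clk s₀) (C.next e a₀ τ s a) + 1 := by
    unfold next
    split_ifs with h
    · exact (C.rem_le_rem_state (by omega) (C.clk_lt s₀) (C.clk_arm_mod hℓe hs₀) s hτ
        (Or.inr h.1.1)).1
    · exact (C.rem_le_rem_state (by omega) (C.clk_lt s₀) (C.clk_arm_mod hℓe hs₀) s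
        (C.abs_trk_le s) (Or.inl rfl)).1
  have h1 := pow_le_pow_of_le_one hγ0.le hγ1.le key
  have h2 := pow_le_one₀ hγ0.le hγ1.le (n := n * ℓ)
  have h3 : 0 ≤ 1 / (1 - γ ^ (n * ℓ)) := div_nonneg zero_le_one (by linarith)
  have h4 := mul_le_mul_of_nonneg_left h1 h3
  unfold visits
  rw [pow_succ] at h4
  linarith

section Values

variable [Fintype S] {M : MDP S A}

lemma le_optValue_base [Finite A] (hℓ : 2 ≤ ℓ) (hγ1 : γ < 1)
    {P : S → A → ℝ}
    (h₀ : M.IsTwoPoint (C.next e a₀ 1) (C.next e a₀ (-1)) P)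
    (hr : M.reward = fun s => (1 + (C.trk s : ℝ)) / 2) (hd : M.discount = γ) (s : S) :
    C.base γ s ≤ M.optValue s := by
  refine M.le_optValue_of_bellman (fun _ => a₀) (fun s => ?_) s
  rw [h₀, hd, hr, C.reward_add_base hℓ hγ1, if_neg (fun h => h.2 rfl), add_zero]

open Classical in
-- `G` is the discounted number of departures. Each one loses at least the gain over `e` steps, as
-- at least `e` positions of the group lie after an arm.
lemma value_le_base_sub (hℓe : ℓ + 1 = 3 * e) (hγ0 : 0 < γ) (hγ1 : γ < 1)
    (hΔ : 0 ≤ Δ)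
    (h₀ : M.IsTwoPoint (C.next e a₀ 1) (C.next e a₀ (-1)) fun _ _ => 1 / 2 - Δ)
    (hr : M.reward = fun s => (1 + (C.trk s : ℝ)) / 2) (hd : M.discount = γ) (π : Policy S A)
    {G : List S → S → ℝ} {B : ℝ} (hGB : ∀ h s, G h s ≤ B)
    (hG : ∀ h s, G h s = (if C.Arm e s ∧ π (h ++ [s]) ≠ a₀ then 1 else 0) + γ * M.nextExp π G h s)
    (h : List S) (s : S) :
    M.value π h s ≤ C.base γ s - 2 * Δ * γ * trackGain γ e * G h s := by
  have hβ : 0 ≤ 2 * Δ * γ * trackGain γ e := by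
    have := trackGain_nonneg hγ0 hγ1 e
    positivity
  obtain ⟨K, hK⟩ := (Set.finite_range fun s => -C.base γ s).bddAbove
  refine M.value_le_of_bellman π (C := -K - 2 * Δ * γ * trackGain γ e * B)
    (F := fun h s => C.base γ s - 2 * Δ * γ * trackGain γ e * G h s) (fun h s => ?_)
    (fun h s => ?_) h s
  · have h1 : -C.base γ s ≤ K := hK ⟨s, rfl⟩
    have h2 := mul_le_mul_of_nonneg_left (hGB h s) hβ
    linarith
  · have h1 := C.reward_add_base (by omega) hγ1 e a₀ (1 / 2 - Δ) s (π (h ++ [s]))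
    rw [hG h s, h₀.nextExp_eq, h₀.nextExp_eq, hd, hr]
    split_ifs at h1 ⊢ with harm
    · have h2 : trackGain γ e ≤ trackGain γ (ℓ - C.clk s % ℓ - 1) := by
        refine trackGain_mono hγ0 hγ1 ?_
        have := harm.1.2.2
        omega
      have h3 := mul_le_mul_of_nonneg_left h2 (by positivity : 0 ≤ 2 * Δ * γ)
      linarith
    · linarith

open Classical in
-- Only the pair `(s₀, b)` is profitable; the other departures lose and can be dropped from an upper
-- bound.
lemma value_le_base_add (hℓ : 2 ≤ ℓ) (hγ0 : 0 < γ) (hγ1 : γ < 1) (hΔ : 0 ≤ Δ)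
    (hs₀ : C.Arm e s₀) (hb : b ≠ a₀)
    (h₁ : M.IsTwoPoint (C.next e a₀ 1) (C.next e a₀ (-1)) (prob s₀ b (1 / 2 + Δ) (1 / 2 - Δ)))
    (hr : M.reward = fun s => (1 + (C.trk s : ℝ)) / 2) (hd : M.discount = γ) (π : Policy S A)
    {G : List S → S → ℝ} (hG0 : ∀ h s, 0 ≤ G h s)
    (hG : ∀ h s, G h s = (if s = s₀ ∧ π (h ++ [s]) = b then 1 else 0) + γ * M.nextExp π G h s)
    (h : List S) (s : S) :
    M.value π h s
      ≤ C.base γ s + 2 * Δ * γ * trackGain γ (ℓ - C.clk s₀ % ℓ - 1) * G h s := by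
  have hβ : 0 ≤ 2 * Δ * γ * trackGain γ (ℓ - C.clk s₀ % ℓ - 1) := by
    have := trackGain_nonneg hγ0 hγ1 (ℓ - C.clk s₀ % ℓ - 1)
    positivity
  obtain ⟨K, hK⟩ := (Set.finite_range fun s => -C.base γ s).bddAbove
  refine M.value_le_of_bellman π (C := -K)
    (F := fun h s => C.base γ s + 2 * Δ * γ * trackGain γ (ℓ - C.clk s₀ % ℓ - 1) * G h s)
    (fun h s => ?_) (fun h s => ?_) h s
  · have h1 : -C.base γ s ≤ K := hK ⟨s, rfl⟩
    have h2 := mul_nonneg hβ (hG0 h s)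
    linarith
  · have h1 := C.reward_add_base hℓ hγ1 e a₀ (prob s₀ b (1 / 2 + Δ) (1 / 2 - Δ) s (π (h ++ [s]))) s
      (π (h ++ [s]))
    rw [hG h s, h₁.nextExp_eq, h₁.nextExp_eq, hd, hr]
    by_cases hp : s = s₀ ∧ π (h ++ [s]) = b
    · have harm : C.Arm e s ∧ π (h ++ [s]) ≠ a₀ := ⟨hp.1 ▸ hs₀, hp.2 ▸ hb⟩
      have hpr : prob s₀ b (1 / 2 + Δ) (1 / 2 - Δ) s (π (h ++ [s])) = 1 / 2 + Δ := if_pos hp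
      rw [if_pos harm, hpr, hp.1] at h1
      rw [if_pos hp, hpr, hp.1]
      linarith
    · have hpr : prob s₀ b (1 / 2 + Δ) (1 / 2 - Δ) s (π (h ++ [s])) = 1 / 2 - Δ := if_neg hp
      rw [hpr] at h1
      rw [if_neg hp, hpr]
      have h2 := trackGain_nonneg hγ0 hγ1 (ℓ - C.clk s % ℓ - 1)
      split_ifs at h1
      · have h3 := mul_nonneg (by positivity : 0 ≤ 2 * Δ * γ) h2
        linarith
      · linarith

open Classical in
-- The policy that plays `b` in `s₀` and keeps the track elsewhere uses the pair once per
-- revolution.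
lemma le_optValue_visits [Finite A] (hℓe : ℓ + 1 = 3 * e) (hγ0 : 0 < γ) (hγ1 : γ < 1)
    (hs₀ : C.Arm e s₀) (hb : b ≠ a₀)
    (h₁ : M.IsTwoPoint (C.next e a₀ 1) (C.next e a₀ (-1)) (prob s₀ b (1 / 2 + Δ) (1 / 2 - Δ)))
    (hr : M.reward = fun s => (1 + (C.trk s : ℝ)) / 2) (hd : M.discount = γ) (s : S) :
    C.base γ s + 2 * Δ * γ * trackGain γ (ℓ - C.clk s₀ % ℓ - 1) * C.visits γ (C.clk s₀) s
      ≤ M.optValue s := by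
  have hℓ : 2 ≤ ℓ := by omega
  refine M.le_optValue_of_bellman (fun s => if s = s₀ then b else a₀)
    (F := fun s => C.base γ s
      + 2 * Δ * γ * trackGain γ (ℓ - C.clk s₀ % ℓ - 1) * C.visits γ (C.clk s₀) s) (fun s => ?_) s
  rw [h₁, hd, hr]
  have h1 := C.reward_add_base hℓ hγ1 e a₀ (prob s₀ b (1 / 2 + Δ) (1 / 2 - Δ) s
    (if s = s₀ then b else a₀)) s (if s = s₀ then b else a₀)
  have hn : 0 < n * ℓ := (Nat.zero_le _).trans_lt (C.clk_lt s₀)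
  by_cases hs : s = s₀
  · subst hs
    have harm : C.Arm e s ∧ b ≠ a₀ := ⟨hs₀, hb⟩
    have hpr : prob s b (1 / 2 + Δ) (1 / 2 - Δ) s b = 1 / 2 + Δ := if_pos ⟨rfl, rfl⟩
    have hv : ∀ τ : ℤ, |τ| ≤ 1 → C.visits γ (C.clk s) s
        = 1 + γ * C.visits γ (C.clk s) (C.next e a₀ τ s b) := fun τ hτ => by
      rw [C.next_of_arm harm]
      exact C.one_add_visits hn hγ0 hγ1 (C.rem_arm hs₀.1) (C.rem_next_arm hℓe hs₀ hτ)
    have hv1 := hv 1 (by norm_num)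
    have hv2 := hv (-1) (by norm_num)
    simp only [if_true] at h1 ⊢
    rw [if_pos harm, hpr] at h1
    rw [hpr]
    refine le_of_eq ?_
    linear_combination -h1 + 2 * Δ * γ * trackGain γ (ℓ - C.clk s % ℓ - 1) *
      ((1 / 2 + Δ) * hv1 + (1 / 2 - Δ) * hv2)
  · simp only [hs, if_false] at h1 ⊢
    rw [if_neg (fun h => h.2 rfl)] at h1
    have hnx : ∀ τ : ℤ, C.next e a₀ τ s a₀ = C.state (C.clk s + 1) (C.trk s) := fun τ =>
      C.next_of_not_arm (fun h => h.2 rfl) τ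
    have hrem := (C.rem_le_rem_state hℓ (C.clk_lt s₀) (C.clk_arm_mod hℓe hs₀) s
      (C.abs_trk_le s) (Or.inl rfl)).2.1 rfl
      (fun h => hs (C.eq_of_arm hℓe hs₀ h.2 h.1))
    have hv := C.visits_eq (γ := γ) hrem
    rw [pow_one] at hv
    simp only [hnx] at h1 ⊢
    refine le_of_eq ?_
    linear_combination -h1 + 2 * Δ * γ * trackGain γ (ℓ - C.clk s₀ % ℓ - 1) * hv

open Classical in
-- No transition brings the clock position of `s₀` on the track 0 nearer by more than one step, and
-- after a use the next one is a full revolution away. So `visits` is a supersolution.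
lemma le_visits (hℓe : ℓ + 1 = 3 * e) (hγ0 : 0 < γ) (hγ1 : γ < 1)
    (hs₀ : C.Arm e s₀) (hb : b ≠ a₀) {P : S → A → ℝ} (hP : ∀ s a, P s a ∈ Set.Icc (0 : ℝ) 1)
    (h₁ : M.IsTwoPoint (C.next e a₀ 1) (C.next e a₀ (-1)) P) (hd : M.discount = γ) (π : Policy S A)
    {G : List S → S → ℝ} {B : ℝ} (hGB : ∀ h s, G h s ≤ B)
    (hG : ∀ h s, G h s = (if s = s₀ ∧ π (h ++ [s]) = b then 1 else 0) + γ * M.nextExp π G h s)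
    (h : List S) (s : S) : G h s ≤ C.visits γ (C.clk s₀) s := by
  have hn : 0 < n * ℓ := (Nat.zero_le _).trans_lt (C.clk_lt s₀)
  refine M.le_of_bellman π (fun h s => if s = s₀ ∧ π (h ++ [s]) = b then 1 else 0) (C := B)
    (F := G) (G := fun _ s => C.visits γ (C.clk s₀) s)
    (fun h s => by linarith [hGB h s, C.visits_nonneg hγ0 hγ1 (C.clk s₀) s])
    (fun h s => by rw [hd]; exact (hG h s).le) (fun h s => ?_) h s
  rw [h₁.nextExp_eq, hd]
  obtain ⟨hp0, hp1⟩ := hP s (π (h ++ [s]))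
  by_cases hp : s = s₀ ∧ π (h ++ [s]) = b
  · have harm : C.Arm e s₀ ∧ b ≠ a₀ := ⟨hs₀, hb⟩
    have hv : ∀ τ : ℤ, |τ| ≤ 1 → C.visits γ (C.clk s₀) s₀
        = 1 + γ * C.visits γ (C.clk s₀) (C.next e a₀ τ s₀ b) := fun τ hτ => by
      rw [C.next_of_arm harm]
      exact C.one_add_visits hn hγ0 hγ1 (C.rem_arm hs₀.1) (C.rem_next_arm hℓe hs₀ hτ)
    have hv1 := hv 1 (by norm_num)
    have hv2 := hv (-1) (by norm_num)
    rw [if_pos hp, hp.2, hp.1]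
    refine le_of_eq ?_
    linear_combination -P s₀ b * hv1 - (1 - P s₀ b) * hv2
  · rw [if_neg hp]
    have h1 := mul_le_mul_of_nonneg_left (C.visits_next_le hℓe hγ0 hγ1 hs₀ a₀
      (τ := 1) (by norm_num) s (π (h ++ [s]))) hp0
    have h2 := mul_le_mul_of_nonneg_left (C.visits_next_le hℓe hγ0 hγ1 hs₀ a₀
      (τ := -1) (by norm_num) s (π (h ++ [s]))) (sub_nonneg.2 hp1)
    linarith

end Values

end ClockSystem

/-! ### Trajectories on the ring -/

namespace ClockSystem

variable {S A : Type*} {ℓ n : ℕ} (C : ClockSystem S ℓ n) {e : ℕ} {a₀ b : A} {s₀ : S} {γ Δ : ℝ}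
  {π : Policy S A} {ω : ℕ → S}

/-- A trajectory that starts at the beginning of the clock and follows the possible transitions. -/
def Legal (e : ℕ) (a₀ : A) (π : Policy S A) (ω : ℕ → S) : Prop :=
  ω 0 = C.state 0 0 ∧ ∀ t, ω (t + 1) = C.next e a₀ 1 (ω t) (π (pastStates ω (t + 1)))
    ∨ ω (t + 1) = C.next e a₀ (-1) (ω t) (π (pastStates ω (t + 1)))

/-- At time `t` the policy leaves the track `0`. -/
def Pull (e : ℕ) (a₀ : A) (π : Policy S A) (ω : ℕ → S) (t : ℕ) : Prop :=
  C.Arm e (ω t) ∧ π (pastStates ω (t + 1)) ≠ a₀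

lemma ae_legal [Fintype S] [MeasurableSpace S] [DiscreteMeasurableSpace S] {M : MDP S A}
    {P : S → A → ℝ} (hM : M.IsTwoPoint (C.next e a₀ 1) (C.next e a₀ (-1)) P)
    (hn : M.HasNextStates (C.next e a₀ 1) (C.next e a₀ (-1))) (π : Policy S A) :
    ∀ᵐ ω ∂M.law π (C.state 0 0), C.Legal e a₀ π ω := by
  filter_upwards [M.ae_start π (C.state 0 0), hM.ae_step hn π (C.state 0 0)] with ω h1 h2
  exact ⟨h1, h2⟩

section Trajectory

variable {C}

lemma Legal.clk_eq (h : C.Legal e a₀ π ω) (t : ℕ) : C.clk (ω t) = t % (n * ℓ) := by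
  induction t with
  | zero => rw [h.1, C.clk_state _ _ (by norm_num)]
  | succ t ih =>
    have : C.clk (ω (t + 1)) = (C.clk (ω t) + 1) % (n * ℓ) := by
      rcases h.2 t with h1 | h1 <;> rw [h1]
      · exact C.clk_next a₀ (by norm_num) _ _
      · exact C.clk_next a₀ (by norm_num) _ _
    rw [this, ih, Nat.mod_add_mod]

lemma Legal.clk_mod (h : C.Legal e a₀ π ω) (t : ℕ) : C.clk (ω t) % ℓ = t % ℓ := by
  rw [h.clk_eq, Nat.mod_mul_left_mod]

lemma Legal.clk_succ_mod (h : C.Legal e a₀ π ω) (t : ℕ) : (C.clk (ω t) + 1) % ℓ = (t + 1) % ℓ := by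
  rw [Nat.add_mod, h.clk_mod, ← Nat.add_mod]

lemma Legal.succ_of_not_pull (h : C.Legal e a₀ π ω) {t : ℕ} (ht : ¬ C.Pull e a₀ π ω t) :
    ω (t + 1) = C.state (C.clk (ω t) + 1) (C.trk (ω t)) := by
  rcases h.2 t with h1 | h1 <;> rw [h1] <;> exact C.next_of_not_arm ht _

lemma Legal.trk_succ_of_not_pull (h : C.Legal e a₀ π ω) {t : ℕ} (ht : ¬ C.Pull e a₀ π ω t) :
    C.trk (ω (t + 1)) = if (t + 1) % ℓ = 0 then 0 else C.trk (ω t) := by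
  rw [h.succ_of_not_pull ht, C.trk_state _ _ (C.abs_trk_le _), h.clk_succ_mod]

lemma Legal.trk_succ_of_pull (h : C.Legal e a₀ π ω) {t : ℕ} (ht : C.Pull e a₀ π ω t)
    (htl : (t + 1) % ℓ ≠ 0) : C.trk (ω (t + 1)) ≠ 0 := by
  rcases h.2 t with h1 | h1
  all_goals
    rw [h1, C.next_of_arm ht, C.trk_state _ _ (by norm_num), h.clk_succ_mod, if_neg htl]
    norm_num

lemma Legal.trk_eq_zero_of_mod (h : C.Legal e a₀ π ω) {t : ℕ} (ht : t % ℓ = 0) :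
    C.trk (ω t) = 0 := C.trk_eq_zero _ (by rw [h.clk_mod, ht])

lemma Legal.trk_eq_zero (h : C.Legal e a₀ π ω) {t : ℕ} (ht : t % ℓ = 0) {k : ℕ}
    (hk : ∀ j < k, ¬ C.Pull e a₀ π ω (t + j)) : C.trk (ω (t + k)) = 0 := by
  induction k with
  | zero => exact h.trk_eq_zero_of_mod ht
  | succ k ih =>
    rw [← add_assoc, h.trk_succ_of_not_pull (hk k (Nat.lt_succ_self k)),
      ih fun j hj => hk j (hj.trans (Nat.lt_succ_self k)), ite_self]

lemma mod_ne_zero_of_div_eq {ℓ u v : ℕ} (hvu : v < u) (h : v / ℓ = u / ℓ) :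
    u % ℓ ≠ 0 := by
  have h1 := Nat.div_add_mod u ℓ
  have h2 := Nat.div_add_mod v ℓ
  rw [h] at h2
  omega

/-- A side track merges into the track 0 only at the start of the next group, and outside the track
0 there are no arms. Hence there is at most one departure per passage through a group. -/
lemma Legal.trk_ne_zero_of_pull (h : C.Legal e a₀ π ω) {v : ℕ}
    (hv : C.Pull e a₀ π ω v) {k : ℕ} (hk : v / ℓ = (v + 1 + k) / ℓ) :
    C.trk (ω (v + 1 + k)) ≠ 0 := by
  induction k with
  | zero => exact h.trk_succ_of_pull hv (mod_ne_zero_of_div_eq (Nat.lt_succ_self v) hk)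
  | succ k ih =>
    have h1 : v / ℓ ≤ (v + 1 + k) / ℓ := Nat.div_le_div_right (by omega)
    have h2 : (v + 1 + k) / ℓ ≤ (v + 1 + (k + 1)) / ℓ := Nat.div_le_div_right (by omega)
    have h3 := ih (by omega)
    rw [← add_assoc, h.trk_succ_of_not_pull fun hp => h3 hp.1.1,
      if_neg (mod_ne_zero_of_div_eq (by omega : v < v + 1 + k + 1) hk)]
    exact h3

lemma Legal.not_pull_of_pull (h : C.Legal e a₀ π ω) {u v : ℕ}
    (hu : C.Pull e a₀ π ω u) (hvu : v < u) (hd : v / ℓ = u / ℓ) : ¬ C.Pull e a₀ π ω v := by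
  intro hv
  obtain ⟨k, rfl⟩ := Nat.exists_eq_add_of_le (Nat.succ_le_of_lt hvu)
  exact h.trk_ne_zero_of_pull hv hd hu.1.1

lemma Legal.eq_of_pull (h : C.Legal e a₀ π ω) {u v : ℕ} (hu : C.Pull e a₀ π ω u)
    (hv : C.Pull e a₀ π ω v) (hd : u / ℓ = v / ℓ) : u = v := by
  rcases lt_trichotomy u v with h1 | h1 | h1
  · exact absurd hu (h.not_pull_of_pull hv h1 hd)
  · exact h1
  · exact absurd hv (h.not_pull_of_pull hu h1 hd.symm)

lemma Legal.nextExp_of_not_pull [Fintype S] {M : MDP S A} {P : S → A → ℝ}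
    (hM : M.IsTwoPoint (C.next e a₀ 1) (C.next e a₀ (-1)) P) (h : C.Legal e a₀ π ω) {t : ℕ}
    (ht : ¬ C.Pull e a₀ π ω t) (G : List S → S → ℝ) :
    M.nextExp π G (pastStates ω t) (ω t) = G (pastStates ω (t + 1)) (ω (t + 1)) := by
  rw [hM.nextExp_eq, ← pastStates_succ, C.next_of_not_arm ht, C.next_of_not_arm ht,
    h.succ_of_not_pull ht]
  ring

open Classical in
-- There is no earlier departure in the same passage, so the steps from `t` to the departure are
-- deterministic. It is therefore certain at time `t` and contributes γ^k.
lemma Legal.pow_le_of_pull [Fintype S] {M : MDP S A} {P : S → A → ℝ}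
    (hM : M.IsTwoPoint (C.next e a₀ 1) (C.next e a₀ (-1)) P) (h : C.Legal e a₀ π ω)
    (hγ0 : 0 < γ) {G : List S → S → ℝ} (hG0 : ∀ h s, 0 ≤ G h s)
    (hG : ∀ h s, G h s = (if C.Arm e s ∧ π (h ++ [s]) ≠ a₀ then 1 else 0) + γ * M.nextExp π G h s)
    {t k : ℕ} (hp : C.Pull e a₀ π ω (t + k)) (hd : t / ℓ = (t + k) / ℓ) :
    γ ^ k ≤ G (pastStates ω t) (ω t) := by
  induction k generalizing t with
  | zero =>
    have hp' : C.Arm e (ω t) ∧ π (pastStates ω t ++ [ω t]) ≠ a₀ := by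
      rw [← pastStates_succ]; exact hp
    rw [hG, if_pos hp', hM.nextExp_eq, pow_zero, ← hM.nextExp_eq]
    have := M.nextExp_mono π (F := fun _ _ => 0) hG0 (pastStates ω t) (ω t)
    rw [M.nextExp_const] at this
    nlinarith
  | succ k ih =>
    have hnp := h.not_pull_of_pull hp (by omega : t < t + (k + 1)) hd
    have h1 : t / ℓ ≤ (t + 1) / ℓ := Nat.div_le_div_right (by omega)
    have h2 : (t + 1) / ℓ ≤ (t + (k + 1)) / ℓ := Nat.div_le_div_right (by omega)
    have e1 : t + (k + 1) = t + 1 + k := by ring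
    rw [e1] at hp hd h2
    have h3 := ih hp (by omega)
    have hnp' : ¬ (C.Arm e (ω t) ∧ π (pastStates ω t ++ [ω t]) ≠ a₀) := by
      rw [← pastStates_succ]; exact hnp
    rw [hG, if_neg hnp', h.nextExp_of_not_pull hM hnp, zero_add, pow_succ, mul_comm]
    exact mul_le_mul_of_nonneg_left h3 hγ0.le

open Classical in
-- Up to the first departure the passage is deterministic, so it is already decided at time `t`
-- whether the pair will be used in it. If it is not, either by an earlier departure or by another
-- action in `s₀`, the next opportunity is a full revolution later, whence the factor γ^(nℓ).
lemma Legal.le_visits_of_not_pull [Fintype S] {M : MDP S A} {P : S → A → ℝ}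
    (hM : M.IsTwoPoint (C.next e a₀ 1) (C.next e a₀ (-1)) P) (h : C.Legal e a₀ π ω)
    (hP : ∀ s a, P s a ∈ Set.Icc (0 : ℝ) 1)
    (hℓe : ℓ + 1 = 3 * e) (hγ0 : 0 < γ) (hs₀ : C.Arm e s₀)
    {G : List S → S → ℝ} (hGv : ∀ h s, G h s ≤ C.visits γ (C.clk s₀) s)
    (hG : ∀ h s, G h s = (if s = s₀ ∧ π (h ++ [s]) = b then 1 else 0) + γ * M.nextExp π G h s)
    {t k : ℕ} (hclk : C.clk (ω t) + k = C.clk s₀) (hstart : C.clk s₀ - C.clk s₀ % ℓ ≤ C.clk (ω t))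
    (htrk : C.trk (ω t) = 0) (hp : ¬ (ω (t + k) = s₀ ∧ π (pastStates ω (t + k + 1)) = b)) :
    G (pastStates ω t) (ω t) ≤ γ ^ (n * ℓ) * C.visits γ (C.clk s₀) (ω t) := by
  have hℓ : 2 ≤ ℓ := by omega
  have hmodlt := C.clk_arm_mod hℓe hs₀
  induction k generalizing t with
  | zero =>
    rw [add_zero] at hclk
    obtain rfl := C.eq_of_arm hℓe hs₀ htrk hclk
    have hnp : ¬ (ω t = ω t ∧ π (pastStates ω t ++ [ω t]) = b) := by
      rw [← pastStates_succ]; exact hp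
    rw [hG, if_neg hnp, hM.nextExp_eq, zero_add]
    have key : ∀ τ : ℤ, |τ| ≤ 1 → ∀ a l, γ * G l (C.next e a₀ τ (ω t) a)
        ≤ γ ^ (n * ℓ) * C.visits γ (C.clk (ω t)) (ω t) := by
      intro τ hτ a l
      have hv : ∀ σ : ℤ, |σ| ≤ 1 → C.rem (C.clk (ω t)) (C.state (C.clk (ω t) + 1) σ) + 1
          = C.rem (C.clk (ω t)) (ω t) + n * ℓ := fun σ hσ => by
        rw [C.rem_next_arm hℓe hs₀ hσ, C.rem_arm hs₀.1, zero_add]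
      have hvis : γ * C.visits γ (C.clk (ω t)) (C.next e a₀ τ (ω t) a)
          = γ ^ (n * ℓ) * C.visits γ (C.clk (ω t)) (ω t) := by
        unfold next visits
        split_ifs
        · have h1 := hv τ hτ
          calc _ = 1 / (1 - γ ^ (n * ℓ)) * γ ^ (C.rem (C.clk (ω t))
                (C.state (C.clk (ω t) + 1) τ) + 1) := by ring
            _ = _ := by rw [h1]; ring
        · have h1 := hv _ (C.abs_trk_le (ω t))
          calc _ = 1 / (1 - γ ^ (n * ℓ)) * γ ^ (C.rem (C.clk (ω t))
                (C.state (C.clk (ω t) + 1) (C.trk (ω t))) + 1) := by ring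
            _ = _ := by rw [h1]; ring
      rw [← hvis]
      exact mul_le_mul_of_nonneg_left (hGv _ _) hγ0.le
    obtain ⟨hp0, hp1⟩ := hP (ω t) (π (pastStates ω t ++ [ω t]))
    have h1 := mul_le_mul_of_nonneg_left (key 1 (by norm_num) (π (pastStates ω t ++ [ω t]))
      (pastStates ω t ++ [ω t])) hp0
    have h2 := mul_le_mul_of_nonneg_left (key (-1) (by norm_num) (π (pastStates ω t ++ [ω t]))
      (pastStates ω t ++ [ω t])) (sub_nonneg.2 hp1)
    linarith
  | succ k ih =>
    have hne : ¬ (ω t = s₀ ∧ π (pastStates ω t ++ [ω t]) = b) := fun hh => by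
      rw [hh.1] at hclk; omega
    have hrem := @rem_le_rem_state S ℓ n C hℓ (C.clk s₀) (C.clk_lt s₀) hmodlt (ω t)
    by_cases hpull : C.Pull e a₀ π ω t
    · rw [hG, if_neg hne, hM.nextExp_eq, zero_add, ← pastStates_succ, C.next_of_arm hpull,
        C.next_of_arm hpull]
      have key : ∀ τ : ℤ, |τ| ≤ 1 → τ ≠ 0 → ∀ l, γ * G l (C.state (C.clk (ω t) + 1) τ)
          ≤ γ ^ (n * ℓ) * C.visits γ (C.clk s₀) (ω t) := by
        intro τ hτ hτ0 l
        have h1 := (hrem hτ (Or.inr htrk)).2.2 htrk (by omega) hstart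
          (Or.inr ⟨hτ0, by have := hpull.1.2.2; omega⟩)
        have hvis : γ * C.visits γ (C.clk s₀) (C.state (C.clk (ω t) + 1) τ)
            = γ ^ (n * ℓ) * C.visits γ (C.clk s₀) (ω t) := by
          unfold visits
          calc _ = 1 / (1 - γ ^ (n * ℓ)) * γ ^ (C.rem (C.clk s₀)
                (C.state (C.clk (ω t) + 1) τ) + 1) := by ring
            _ = _ := by rw [h1]; ring
        rw [← hvis]
        exact mul_le_mul_of_nonneg_left (hGv _ _) hγ0.le
      obtain ⟨hp0, hp1⟩ := hP (ω t) (π (pastStates ω (t + 1)))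
      have h1 := mul_le_mul_of_nonneg_left
        (key 1 (by norm_num) (by norm_num) (pastStates ω (t + 1))) hp0
      have h2 := mul_le_mul_of_nonneg_left
        (key (-1) (by norm_num) (by norm_num) (pastStates ω (t + 1))) (sub_nonneg.2 hp1)
      linarith
    · have hω := h.succ_of_not_pull hpull
      have hlt : C.clk (ω t) + 1 < n * ℓ := by
        have := C.clk_lt s₀
        omega
      have hclk' : C.clk (ω (t + 1)) = C.clk (ω t) + 1 := by
        rw [hω, C.clk_state _ _ (C.abs_trk_le _), Nat.mod_eq_of_lt hlt]
      have htrk' : C.trk (ω (t + 1)) = 0 := by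
        rw [h.trk_succ_of_not_pull hpull, htrk, ite_self]
      have e1 : t + (k + 1) = t + 1 + k := by ring
      rw [e1] at hp
      have h3 := ih (t := t + 1) (by omega) (by omega) htrk' hp
      have h4 := (hrem (C.abs_trk_le (ω t)) (Or.inl rfl)).2.1 rfl (fun hh => by omega)
      rw [← hω] at h4
      have h5 := C.visits_eq (γ := γ) h4
      rw [pow_one] at h5
      rw [hG, if_neg hne, h.nextExp_of_not_pull hM hpull, zero_add, h5]
      calc _ ≤ γ * (γ ^ (n * ℓ) * C.visits γ (C.clk s₀) (ω (t + 1))) :=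
            mul_le_mul_of_nonneg_left h3 hγ0.le
        _ = _ := by ring

end Trajectory

end ClockSystem

/-! ### Errors on the ring -/

namespace ClockSystem

variable {S A : Type*} {ℓ n : ℕ} (C : ClockSystem S ℓ n) {e : ℕ} {a₀ b : A} {s₀ : S} {γ Δ ε : ℝ}
  {π : Policy S A} {ω : ℕ → S}

lemma mul_pow_le_one_sub_pow (hγ0 : 0 < γ) (hγ1 : γ < 1) (k : ℕ) :
    k * γ ^ k * (1 - γ) ≤ 1 - γ ^ k := by
  induction k with
  | zero => simp
  | succ k ih =>
    have h1 : 0 < γ ^ k := pow_pos hγ0 k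
    have h2 : (0 : ℝ) ≤ k := Nat.cast_nonneg k
    have h3 : 0 < 1 - γ := by linarith
    rw [pow_succ]
    push_cast
    nlinarith [mul_nonneg (mul_nonneg (mul_nonneg h2 h1.le) h3.le) h3.le,
      mul_nonneg (mul_nonneg h1.le h3.le) h3.le]

open Classical in
-- Each group has `e` arm positions, at the offsets e-1, …, 2e-2.
lemma card_arm_ge [Fintype S] [Fintype A] (hℓe : ℓ + 1 = 3 * e)
    [Fintype {x : S × A // C.Arm e x.1 ∧ x.2 ≠ a₀}] :
    n * e * (Fintype.card A - 1) ≤ Fintype.card {x : S × A // C.Arm e x.1 ∧ x.2 ≠ a₀} := by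
  have hmod : ∀ (g : Fin n) (i : Fin e), (g.val * ℓ + (e - 1 + i.val)) % ℓ = e - 1 + i.val ∧
      (g.val * ℓ + (e - 1 + i.val)) / ℓ = g.val ∧ g.val * ℓ + (e - 1 + i.val) < n * ℓ := by
    intro g i
    have hi := i.isLt
    have h1 : e - 1 + i.val < ℓ := by omega
    have h2 := Nat.mul_le_mul_right ℓ (Nat.succ_le_of_lt g.isLt)
    rw [Nat.succ_mul] at h2
    refine ⟨?_, ?_, by omega⟩
    · rw [mul_comm, Nat.mul_add_mod, Nat.mod_eq_of_lt h1]
    · rw [mul_comm, Nat.mul_add_div (by omega), Nat.div_eq_of_lt h1, add_zero]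
  have hclk : ∀ (g : Fin n) (i : Fin e), C.clk (C.state (g.val * ℓ + (e - 1 + i.val)) 0)
      = g.val * ℓ + (e - 1 + i.val) := fun g i => by
    rw [C.clk_state _ _ (by norm_num), Nat.mod_eq_of_lt (hmod g i).2.2]
  let F : Fin n × Fin e × {a : A // a ≠ a₀} → {x : S × A // C.Arm e x.1 ∧ x.2 ≠ a₀} := fun x =>
    ⟨(C.state (x.1.val * ℓ + (e - 1 + x.2.1.val)) 0, x.2.2.1), ⟨by
      rw [C.trk_state _ _ (by norm_num), ite_self], by
      rw [hclk, (hmod x.1 x.2.1).1]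
      have := x.2.1.isLt
      omega⟩, x.2.2.2⟩
  have hF : Function.Injective F := by
    rintro ⟨g, i, a⟩ ⟨g', i', a'⟩ h
    have h1 := congrArg Subtype.val h
    simp only [F, Prod.mk.injEq] at h1
    have h2 := congrArg C.clk h1.1
    rw [hclk, hclk] at h2
    have hg : g = g' := Fin.ext (by rw [← (hmod g i).2.1, h2, (hmod g' i').2.1])
    have hi : i = i' := Fin.ext (by
      have h3 := (hmod g i).1
      rw [h2, (hmod g' i').1] at h3
      omega)
    rw [hg, hi, Subtype.ext h1.2]
  have hcard := Fintype.card_le_of_injective F hF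
  rwa [Fintype.card_prod, Fintype.card_prod, Fintype.card_fin, Fintype.card_fin,
    Fintype.card_subtype_compl, Fintype.card_subtype_eq, ← mul_assoc] at hcard

section Errors

variable {C} [Fintype S] {M : MDP S A}

/-- Arms have offset at least e-1, so all of the first `e` positions of the group come no later than
the departure, and it is less than 2e steps away and certain from each of them. Its discounted loss
exceeds ε there. -/
lemma Legal.mem_errorTimes_of_pull [Finite A]
    (hM : M.IsTwoPoint (C.next e a₀ 1) (C.next e a₀ (-1)) fun _ _ => 1 / 2 - Δ)
    (hr : M.reward = fun s => (1 + (C.trk s : ℝ)) / 2) (hd : M.discount = γ)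
    (hℓe : ℓ + 1 = 3 * e) (hγ0 : 0 < γ) (hγ1 : γ < 1) (hΔ : 0 ≤ Δ)
    (hε : ε < 2 * Δ * γ * trackGain γ e * γ ^ (2 * e)) (h : C.Legal e a₀ π ω) {u i : ℕ}
    (hu : C.Pull e a₀ π ω u) (hi : i < e) :
    u / ℓ * ℓ + i ≤ u ∧ u / ℓ * ℓ + i ∈ M.errorTimes π ε ω := by
  classical
  let f : List S → S → ℝ := fun h s => if C.Arm e s ∧ π (h ++ [s]) ≠ a₀ then 1 else 0
  have hf : ∀ h s, f h s ∈ Set.Icc (0 : ℝ) 1 := fun h s => by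
    simp only [f]; split_ifs <;> simp
  have hGI := fun h s => M.discVal_mem_Icc π hf h s
  have hG : ∀ h s, M.discVal π f h s = f h s + γ * M.nextExp π (M.discVal π f) h s :=
    fun h s => by rw [← hd]; exact M.discVal_eq π hf h s
  have hpos := hu.1.2
  rw [h.clk_mod] at hpos
  have hdm := Nat.div_add_mod' u ℓ
  have hle : u / ℓ * ℓ + i ≤ u := by omega
  refine ⟨hle, ?_⟩
  obtain ⟨k, hk⟩ := Nat.exists_eq_add_of_le hle
  have hdiv : (u / ℓ * ℓ + i) / ℓ = u / ℓ := by
    rw [mul_comm, Nat.mul_add_div (by omega), Nat.div_eq_of_lt (by omega : i < ℓ), add_zero]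
  have h1 := h.pow_le_of_pull hM hγ0 (fun h s => (hGI h s).1) hG (t := u / ℓ * ℓ + i) (k := k)
    (hk ▸ hu) (by rw [hdiv, ← hk])
  have h2 : γ ^ (2 * e) ≤ γ ^ k := pow_le_pow_of_le_one hγ0.le hγ1.le (by omega)
  have h3 := C.value_le_base_sub hℓe hγ0 hγ1 hΔ hM hr hd π (fun h s => (hGI h s).2) hG
    (pastStates ω (u / ℓ * ℓ + i)) (ω (u / ℓ * ℓ + i))
  have h4 := C.le_optValue_base (by omega) hγ1 hM hr hd (ω (u / ℓ * ℓ + i))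
  have h5 : 0 ≤ 2 * Δ * γ * trackGain γ e := by
    have := trackGain_nonneg hγ0 hγ1 e
    positivity
  have h6 := mul_le_mul_of_nonneg_left (h2.trans h1) h5
  have : ε < M.optValue (ω (u / ℓ * ℓ + i))
      - M.value π (pastStates ω (u / ℓ * ℓ + i)) (ω (u / ℓ * ℓ + i)) := by linarith
  exact this

open Classical in
/-- Every departure from the track `0` is preceded by `e` errors of its own if staying on this track
is optimal. -/
lemma Legal.mul_card_pull_le [Finite A]
    (hM : M.IsTwoPoint (C.next e a₀ 1) (C.next e a₀ (-1)) fun _ _ => 1 / 2 - Δ)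
    (hr : M.reward = fun s => (1 + (C.trk s : ℝ)) / 2) (hd : M.discount = γ)
    (hℓe : ℓ + 1 = 3 * e) (hγ0 : 0 < γ) (hγ1 : γ < 1) (hΔ : 0 ≤ Δ)
    (hε : ε < 2 * Δ * γ * trackGain γ e * γ ^ (2 * e)) (h : C.Legal e a₀ π ω) (T : ℕ) :
    e * ((Finset.range T).filter (C.Pull e a₀ π ω)).card
      ≤ ((Finset.range T).filter (· ∈ M.errorTimes π ε ω)).card := by
  have hcard : e * ((Finset.range T).filter (C.Pull e a₀ π ω)).card
      = ((Finset.range T).filter (C.Pull e a₀ π ω) ×ˢ Finset.range e).card := by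
    rw [Finset.card_product, Finset.card_range, mul_comm]
  rw [hcard]
  -- A departure at `u` is charged to the first `e` times of its passage. Passages are disjoint and
  -- contain at most one departure, so no time is charged twice.
  refine Finset.card_le_card_of_injOn (fun x => x.1 / ℓ * ℓ + x.2) (fun x hx => ?_)
    (fun x hx y hy hxy => ?_)
  · rw [Finset.mem_coe, Finset.mem_product, Finset.mem_filter, Finset.mem_range,
      Finset.mem_range] at hx
    obtain ⟨h1, h2⟩ := h.mem_errorTimes_of_pull hM hr hd hℓe hγ0 hγ1 hΔ hε hx.1.2 hx.2
    exact Finset.mem_coe.2 (Finset.mem_filter.2 ⟨Finset.mem_range.2 (h1.trans_lt hx.1.1), h2⟩)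
  · rw [Finset.mem_coe, Finset.mem_product, Finset.mem_filter, Finset.mem_range,
      Finset.mem_range] at hx hy
    have key : ∀ (k i : ℕ), i < e → (k * ℓ + i) / ℓ = k := fun k i hi => by
      rw [mul_comm, Nat.mul_add_div (by omega), Nat.div_eq_of_lt (by omega : i < ℓ), add_zero]
    simp only at hxy
    have hq : x.1 / ℓ = y.1 / ℓ := by
      rw [← key (x.1 / ℓ) x.2 hx.2, hxy, key _ _ hy.2]
    have h1 := h.eq_of_pull hx.1.2 hy.1.2 hq
    rw [hq] at hxy
    exact Prod.ext h1 (by omega)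

/-- At the start of the group of `s₀` the optimal policy counts all visits, the given one at most
γ^(nℓ) times as many. The difference is γ to the offset of `s₀`, one discounted visit, and is worth
more than ε. -/
lemma Legal.mem_errorTimes_of_not_pull [Finite A] (hΔ1 : Δ ≤ 1 / 2)
    (hM : M.IsTwoPoint (C.next e a₀ 1) (C.next e a₀ (-1)) (prob s₀ b (1 / 2 + Δ) (1 / 2 - Δ)))
    (hr : M.reward = fun s => (1 + (C.trk s : ℝ)) / 2) (hd : M.discount = γ)
    (hℓe : ℓ + 1 = 3 * e) (hγ0 : 0 < γ) (hγ1 : γ < 1) (hΔ : 0 ≤ Δ)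
    (hε : ε < 2 * Δ * γ * trackGain γ e * γ ^ (2 * e)) (hs₀ : C.Arm e s₀) (hb : b ≠ a₀)
    (h : C.Legal e a₀ π ω) {y : ℕ}
    (hp : ¬ (ω (C.clk s₀ + y * (n * ℓ)) = s₀
      ∧ π (pastStates ω (C.clk s₀ + y * (n * ℓ) + 1)) = b)) :
    C.clk s₀ - C.clk s₀ % ℓ + y * (n * ℓ) ∈ M.errorTimes π ε ω := by
  classical
  let f : List S → S → ℝ := fun h s => if s = s₀ ∧ π (h ++ [s]) = b then 1 else 0
  have hf : ∀ h s, f h s ∈ Set.Icc (0 : ℝ) 1 := fun h s => by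
    simp only [f]; split_ifs <;> simp
  have hGI := fun h s => M.discVal_mem_Icc π hf h s
  have hG : ∀ h s, M.discVal π f h s = f h s + γ * M.nextExp π (M.discVal π f) h s :=
    fun h s => by rw [← hd]; exact M.discVal_eq π hf h s
  have hP : ∀ s a, prob s₀ b (1 / 2 + Δ) (1 / 2 - Δ) s a ∈ Set.Icc (0 : ℝ) 1 := fun s a => by
    unfold prob
    split_ifs <;> constructor <;> linarith
  have hcle := Nat.mod_le (C.clk s₀) ℓ
  have hclt := C.clk_lt s₀
  set t := C.clk s₀ - C.clk s₀ % ℓ + y * (n * ℓ) with ht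
  have hclkt : C.clk (ω t) = C.clk s₀ - C.clk s₀ % ℓ := by
    rw [h.clk_eq, ht, Nat.add_mul_mod_self_right, Nat.mod_eq_of_lt (by omega)]
  have hmod : t % ℓ = 0 := by
    rw [← h.clk_mod, hclkt]
    have e1 : C.clk s₀ - C.clk s₀ % ℓ = ℓ * (C.clk s₀ / ℓ) := by
      have := Nat.div_add_mod (C.clk s₀) ℓ
      omega
    rw [e1, Nat.mul_mod_right]
  have htrk := h.trk_eq_zero_of_mod hmod
  have hsum : t + C.clk s₀ % ℓ = C.clk s₀ + y * (n * ℓ) := by omega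
  have h1 := h.le_visits_of_not_pull hM hP hℓe hγ0 hs₀
    (C.le_visits hℓe hγ0 hγ1 hs₀ hb hP hM hd π (fun h s => (hGI h s).2) hG) hG
    (t := t) (k := C.clk s₀ % ℓ) (by omega) (by omega) htrk (by rw [hsum]; exact hp)
  have h2 := C.value_le_base_add (by omega) hγ0 hγ1 hΔ hs₀ hb hM hr hd π
    (fun h s => (hGI h s).1) hG (pastStates ω t) (ω t)
  have h3 := C.le_optValue_visits hℓe hγ0 hγ1 hs₀ hb hM hr hd (ω t)
  have hn : 0 < n * ℓ := (Nat.zero_le _).trans_lt hclt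
  have hrem : C.rem (C.clk s₀) (ω t) = C.clk s₀ % ℓ := by
    unfold rem
    rw [if_pos ⟨by omega, Or.inl htrk⟩]
    omega
  have hvis : C.visits γ (C.clk s₀) (ω t)
      - γ ^ (n * ℓ) * C.visits γ (C.clk s₀) (ω t) = γ ^ (C.clk s₀ % ℓ) := by
    have := pow_lt_one₀ hγ0.le hγ1 hn.ne'
    have h4 : 1 - γ ^ (n * ℓ) ≠ 0 := by linarith
    unfold visits
    rw [hrem]
    field_simp
  have hle := hs₀.2.2
  have hgain : trackGain γ e ≤ trackGain γ (ℓ - C.clk s₀ % ℓ - 1) :=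
    trackGain_mono hγ0 hγ1 (by omega)
  have hpow : γ ^ (2 * e) ≤ γ ^ (C.clk s₀ % ℓ) := pow_le_pow_of_le_one hγ0.le hγ1.le (by omega)
  have h5 : 0 ≤ trackGain γ e := trackGain_nonneg hγ0 hγ1 e
  have h7 : 0 ≤ 2 * Δ * γ * trackGain γ (ℓ - C.clk s₀ % ℓ - 1) := by
    have := h5.trans hgain
    positivity
  have h6 : 2 * Δ * γ * trackGain γ e * γ ^ (2 * e)
      ≤ 2 * Δ * γ * trackGain γ (ℓ - C.clk s₀ % ℓ - 1) * γ ^ (C.clk s₀ % ℓ) :=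
    mul_le_mul (mul_le_mul_of_nonneg_left hgain (by positivity)) hpow (by positivity) h7
  have h8 := mul_le_mul_of_nonneg_left h1 h7
  rw [← hvis] at h6
  have : ε < M.optValue (ω t) - M.value π (pastStates ω t) (ω t) := by linarith
  exact this

end Errors

end ClockSystem

/-! ### The hard ring -/

namespace ClockSystem

/-- The gain over `e` steps is at least eγ^e/2 and (1-γ)e ≥ 1/2000, so 9000/2000 · 1/4 > 1 explains
the constant in `Δ`. -/
lemma lt_trackGain_mul_pow {γ Δ ε : ℝ} {e : ℕ} (hγ0 : 0 < γ) (hγ1 : γ < 1) (hε : 0 < ε)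
    (hΔ : Δ = 9000 * (ε * (1 - γ))) (heγ : 1 ≤ 2000 * ((1 - γ) * e))
    (hpow : 1 / 4 ≤ γ ^ (3 * e + 1)) : ε < 2 * Δ * γ * trackGain γ e * γ ^ (2 * e) := by
  have hη : 0 < 1 - γ := by linarith
  have hΔ0 : 0 < Δ := by rw [hΔ]; positivity
  have h1 : e * γ ^ e / 2 ≤ trackGain γ e := by
    unfold trackGain
    rw [div_le_div_iff₀ (by norm_num) (by positivity)]
    linarith [mul_pow_le_one_sub_pow hγ0 hγ1 e]
  calc ε < 9000 * (ε * (1 / 2000)) * (1 / 4) := by linarith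
    _ ≤ 9000 * (ε * ((1 - γ) * e)) * γ ^ (3 * e + 1) := by
        gcongr
        linarith
    _ = 2 * Δ * γ * (e * γ ^ e / 2) * γ ^ (2 * e) := by rw [hΔ]; ring
    _ ≤ _ := by gcongr

open Classical in
lemma sum_listCount_pair_le {S A : Type*} {ℓ n : ℕ} (C : ClockSystem S ℓ n) (e : ℕ) (a₀ : A)
    (π : Policy S A) [Fintype {x : S × A // C.Arm e x.1 ∧ x.2 ≠ a₀}] (ω : ℕ → S) (T : ℕ) :
    ∑ j : {x : S × A // C.Arm e x.1 ∧ x.2 ≠ a₀},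
      listCount (fun l => l.getLast? = some j.1.1 ∧ π l = j.1.2) (pastStates ω T)
      ≤ ((Finset.range T).filter (C.Pull e a₀ π ω)).card := by
  simp only [listCount_pastStates, Finset.card_filter]
  rw [Finset.sum_comm]
  refine Finset.sum_le_sum fun t _ => ?_
  have hlast : (pastStates ω (t + 1)).getLast? = some (ω t) := by simp [pastStates_succ]
  rw [← Finset.card_filter, hlast]
  split_ifs with hp
  · refine Finset.card_le_one.2 fun i hi j hj => ?_
    rw [Finset.mem_filter] at hi hj
    exact Subtype.ext (Prod.ext (Option.some.inj (hi.2.1.symm.trans hj.2.1))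
      (hi.2.2.symm.trans hj.2.2))
  · refine (Finset.card_eq_zero.2 (Finset.filter_eq_empty_iff.2 fun j _ hj => hp ?_)).le
    have h1 : ω t = j.1.1 := Option.some.inj hj.1
    exact ⟨h1 ▸ j.2.1, hj.2 ▸ j.2.2⟩

open Classical in
lemma card_pulled_le_listCount {S A : Type*} (s₀ : S) (b : A) (π : Policy S A) (ω : ℕ → S)
    {c L X : ℕ} (hc : c < L) :
    ((Finset.range X).filter fun y => ω (c + y * L) = s₀ ∧ π (pastStates ω (c + y * L + 1)) = b).card
      ≤ listCount (fun l => l.getLast? = some s₀ ∧ π l = b) (pastStates ω (X * L)) := by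
  rw [listCount_pastStates]
  refine Finset.card_le_card_of_injOn (fun y => c + y * L) (fun y hy => ?_) fun y _ z _ hyz => ?_
  · rw [Finset.mem_coe, Finset.mem_filter, Finset.mem_range] at hy
    have h1 := Nat.mul_le_mul_right L (Nat.succ_le_of_lt hy.1)
    rw [Nat.succ_mul] at h1
    refine Finset.mem_coe.2 (Finset.mem_filter.2 ⟨Finset.mem_range.2 (show c + y * L < X * L by omega), ?_, hy.2.2⟩)
    simp [pastStates_succ, hy.2.1]
  · simp only [Nat.add_left_cancel_iff] at hyz
    exact Nat.eq_of_mul_eq_mul_right (by omega) hyz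

set_option maxHeartbeats 1000000 in
-- Outside the event of `N` errors in `M₀`, at most N/e departures are shared by the J pairs, so by
-- averaging and Markov some pair is used more than 4N/(eJ) times with probability at most 1/4. If
-- `N` errors in `M₀` have probability less than δ < 1/12, the total exceptional probability is
-- below 1/2.
theorem exists_hard_ring {S A : Type*} [Fintype S] [Fintype A] [MeasurableSpace S]
    [DiscreteMeasurableSpace S] {γ ε δ c₁ : ℝ} {ℓ n e : ℕ} (C : ClockSystem S ℓ n)
    (hℓe : ℓ + 1 = 3 * e) (hn : 1 ≤ n) (hA : 2 ≤ Fintype.card A)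
    (hQ36 : Fintype.card (S × A) ≤ 36 * (n * e * (Fintype.card A - 1)))
    (hQ1 : 1 ≤ Fintype.card (S × A))
    (hγ0 : 0 < γ) (hγ1 : γ < 1) (hε : 0 < ε)
    (hεγ : 90000 * (ε * (1 - γ)) ≤ 1) (heγ : 1 ≤ 2000 * ((1 - γ) * e))
    (hpow : 1 / 4 ≤ γ ^ (3 * e + 1))
    (hδ : 0 < δ) (hδ1 : δ < 1 / 12) (hc0 : 0 < c₁) (hc : 5 * 10 ^ 14 * c₁ ≤ 1)
    (hx1 : 5 * 10 ^ 14 * (ε ^ 2 * (1 - γ) ^ 3) ≤ 1) :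
    ∃ (r : S → ℝ) (s₁ : S) (sp sm : S → A → S),
      ∀ π : Policy S A, ∃ M : MDP S A,
        M.reward = r ∧ M.discount = γ ∧ M.HasNextStates sp sm ∧
        ENNReal.ofReal δ ≤ M.law π s₁
          {ω | ((⌈c₁ * Fintype.card (S × A) / (ε ^ 2 * (1 - γ) ^ 3) *
              Real.log (1 / 12 / δ)⌉₊ : ℕ) : ℕ∞) ≤ (M.errorTimes π ε ω).encard} := by
  classical
  have hη : 0 < 1 - γ := by linarith
  obtain ⟨Δ, hΔ⟩ : ∃ Δ, Δ = 9000 * (ε * (1 - γ)) := ⟨_, rfl⟩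
  have hΔ0 : 0 < Δ := by rw [hΔ]; positivity
  have hΔ1 : Δ ≤ 1 / 10 := by linarith
  have hthr := lt_trackGain_mul_pow hγ0 hγ1 hε hΔ heγ hpow
  obtain ⟨x, hx⟩ : ∃ x, x = ε ^ 2 * (1 - γ) ^ 3 := ⟨_, rfl⟩
  have hx0 : 0 < x := by rw [hx]; positivity
  obtain ⟨Q, hQ⟩ : ∃ Q : ℝ, Q = Fintype.card (S × A) := ⟨_, rfl⟩
  have hQ1' : 1 ≤ Q := by rw [hQ]; exact_mod_cast hQ1
  rw [← hx, ← hQ]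
  rw [← hx] at hx1
  obtain ⟨N, hN⟩ : ∃ N, N = ⌈c₁ * Q / x * Real.log (1 / 12 / δ)⌉₊ := ⟨_, rfl⟩
  rw [← hN]
  have hN0 : 0 < N := by rw [hN]; exact MDP.ceil_pos_of_lt hc0 (by linarith) hx0 hδ hδ1
  have hAne : Nonempty A := Fintype.card_pos_iff.1 (by omega)
  let a₀ : A := Classical.arbitrary A
  let r : S → ℝ := fun s => (1 + (C.trk s : ℝ)) / 2
  have hr : ∀ s, r s ∈ Set.Icc (0 : ℝ) 1 := fun s => by
    have h1 := abs_le.1 (C.abs_trk_le s)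
    have h2 : (-1 : ℝ) ≤ C.trk s := by exact_mod_cast h1.1
    have h3 : (C.trk s : ℝ) ≤ 1 := by exact_mod_cast h1.2
    simp only [r]
    constructor <;> linarith
  refine ⟨r, C.state 0 0, C.next e a₀ 1, C.next e a₀ (-1), fun π => ?_⟩
  obtain ⟨M₀, hr0, hd0, hn0, h₀⟩ := MDP.exists_isTwoPoint (C.next e a₀ 1) (C.next e a₀ (-1))
    (fun _ _ => 1 / 2 - Δ) (fun _ _ => ⟨by linarith, by linarith⟩) r hr γ ⟨hγ0, hγ1⟩
  let ι := {x : S × A // C.Arm e x.1 ∧ x.2 ≠ a₀}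
  obtain ⟨J, hJ⟩ : ∃ J : ℝ, J = Fintype.card ι := ⟨_, rfl⟩
  have hcardι : n * e * (Fintype.card A - 1) ≤ Fintype.card ι := C.card_arm_ge hℓe
  have hJQ : Q ≤ 36 * J := by
    rw [hQ, hJ]
    have : Fintype.card (S × A) ≤ 36 * Fintype.card ι := by omega
    exact_mod_cast this
  have hJ0 : 0 < J := by linarith
  have hιne : Nonempty ι := Fintype.card_pos_iff.1 (by
    rw [hJ] at hJ0; exact_mod_cast hJ0)
  have he0 : 1 ≤ e := by omega
  have heR : (1 : ℝ) ≤ e := by exact_mod_cast he0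
  have hNR : (0 : ℝ) < N := by exact_mod_cast hN0
  obtain ⟨m, hm⟩ : ∃ m, m = ⌊4 * N / (e * J)⌋₊ := ⟨_, rfl⟩
  -- m + N revolutions, at most m of which contain a use of the pair on the event transferred to
  -- `M₁`; each of the other N or more contributes an error.
  obtain ⟨T, hT⟩ : ∃ T, T = (m + N) * (n * ℓ) := ⟨_, rfl⟩
  have hT0 : 0 < T := by
    rw [hT]
    exact Nat.mul_pos (by omega) (Nat.mul_pos hn (by omega))
  let err : List S → Prop := fun l =>
    ∃ s, l.getLast? = some s ∧ ε < M₀.optValue s - M₀.value π l.dropLast s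
  have herrt : ∀ (ω : ℕ → S) t, err (pastStates ω (t + 1)) ↔ t ∈ M₀.errorTimes π ε ω := by
    intro ω t
    simp [err, pastStates_succ, MDP.errorTimes]
  have hcount : ∀ ω : ℕ → S, listCount err (pastStates ω T)
      = ((Finset.range T).filter (· ∈ M₀.errorTimes π ε ω)).card := by
    intro ω
    rw [listCount_pastStates]
    congr 1
    exact Finset.filter_congr fun t _ => herrt ω t
  let E₀ : Set (List S) := {l | N ≤ listCount err l}
  by_cases hE : ENNReal.ofReal δ ≤ M₀.law π (C.state 0 0) {ω | pastStates ω T ∈ E₀}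
  · refine ⟨M₀, hr0, hd0, hn0, hE.trans (measure_mono fun ω hω => ?_)⟩
    have hω' : N ≤ listCount err (pastStates ω T) := hω
    rw [hcount] at hω'
    exact MDP.le_encard_errorTimes _ hω' fun t ht => (Finset.mem_filter.1 ht).2
  let pair : ι → List S → Prop := fun j l => l.getLast? = some j.1.1 ∧ π l = j.1.2
  -- Setting φ to 0 on the exceptional event makes the sum over all pairs at most J/4 almost surely.
  let φ : ι → List S → ℝ := fun j l => if l ∈ E₀ then 0 else e * J / (4 * N) * listCount (pair j) l
  obtain ⟨j, hj⟩ := exists_measure_one_le_le (M₀.law π (C.state 0 0))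
    (fun j ω => φ j (pastStates ω T)) (fun j => MDP.measurable_pastStates (φ j) T)
    (fun j ω => by simp only [φ]; split_ifs <;> positivity) (K := J / 4) (by
      filter_upwards [C.ae_legal h₀ hn0 π] with ω hω
      simp only [φ]
      split_ifs with hmem
      · simp only [Finset.sum_const_zero]
        positivity
      · rw [← Finset.mul_sum]
        have h1 : listCount err (pastStates ω T) < N := not_le.1 hmem
        rw [hcount] at h1
        have h2 := hω.mul_card_pull_le h₀ hr0 hd0 hℓe hγ0 hγ1 hΔ0.le hthr T
        have h3 := C.sum_listCount_pair_le e a₀ π ω T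
        have h4 : e * ∑ j, listCount (pair j) (pastStates ω T) ≤ N :=
          (Nat.mul_le_mul_left e h3).trans (h2.trans h1.le)
        have h5 : (e : ℝ) * ∑ j, (listCount (pair j) (pastStates ω T) : ℝ) ≤ N := by
          exact_mod_cast h4
        calc _ = J / (4 * N) * (e * ∑ j, (listCount (pair j) (pastStates ω T) : ℝ)) := by ring
          _ ≤ J / (4 * N) * N := mul_le_mul_of_nonneg_left h5 (by positivity)
          _ = J / 4 := by field_simp)
  obtain ⟨s₀, hs₀⟩ : ∃ s₀, s₀ = j.1.1 := ⟨_, rfl⟩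
  obtain ⟨b, hb⟩ : ∃ b, b = j.1.2 := ⟨_, rfl⟩
  have harm : C.Arm e s₀ := hs₀ ▸ j.2.1
  have hba : b ≠ a₀ := hb ▸ j.2.2
  have hpair : pair j = fun l => l.getLast? = some s₀ ∧ π l = b := by rw [hs₀, hb]
  have hPmem : ∀ θ : ℝ, 0 ≤ θ → θ ≤ 1 → ∀ s a, prob s₀ b θ (1 / 2 - Δ) s a ∈ Set.Icc (0 : ℝ) 1 := by
    intro θ h1 h2 s a
    unfold prob
    split_ifs
    · exact ⟨h1, h2⟩
    · constructor <;> linarith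
  have hP₁ := hPmem (1 / 2 + Δ) (by linarith) (by linarith)
  obtain ⟨M₁, hr1, hd1, hn1, h₁⟩ := MDP.exists_isTwoPoint (C.next e a₀ 1) (C.next e a₀ (-1))
    (prob s₀ b (1 / 2 + Δ) (1 / 2 - Δ)) hP₁ r hr γ ⟨hγ0, hγ1⟩
  have hp1 : prob s₀ b (1 / 2 + Δ) (1 / 2 - Δ) s₀ b = 1 / 2 + Δ := if_pos ⟨rfl, rfl⟩
  refine ⟨M₁, hr1, hd1, hn1, ?_⟩
  refine h₀.le_law_errorTimes h₁ hP₁ s₀ b (fun s a hsa => (if_neg fun h => hsa h.1 h.2).symm)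
    (by rw [hp1]; linarith) (by rw [hp1]; linarith) (R := 1 + 20 * Δ ^ 2)
    (by nlinarith only [sq_nonneg Δ]) ?_ π _ m T hT0 (B := {l | listCount (pair j) l ≤ m})
    (fun l hl => ?_) ?_ ?_ ?_
  · rw [hp1]
    have h1 : 0 < 1 / 2 + Δ := by linarith
    have h2 : 0 < 1 - (1 / 2 + Δ) := by linarith
    rw [div_add_div _ _ h1.ne' h2.ne', div_le_iff₀ (mul_pos h1 h2)]
    have h3 : Δ ^ 2 ≤ 1 / 100 := by nlinarith only [hΔ0, hΔ1]
    nlinarith only [mul_nonneg (sq_nonneg Δ) (sub_nonneg.2 h3)]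
  · rw [← hpair]; exact hl
  · have hsub : {ω : ℕ → S | pastStates ω T ∈ {l | listCount (pair j) l ≤ m}}ᶜ
        ⊆ {ω | pastStates ω T ∈ E₀} ∪ {ω | 1 ≤ φ j (pastStates ω T)} := by
      intro ω hω
      by_cases hmem : pastStates ω T ∈ E₀
      · exact Or.inl hmem
      · refine Or.inr ?_
        have h1 : m < listCount (pair j) (pastStates ω T) := not_le.1 hω
        rw [hm, Nat.floor_lt (by positivity), div_lt_iff₀ (by positivity)] at h1
        simp only [Set.mem_ofPred_eq, φ, if_neg hmem]
        rw [div_mul_eq_mul_div, one_le_div (by positivity)]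
        linarith
    refine (measure_mono hsub).trans ((measure_union_le _ _).trans ?_)
    calc _ ≤ ENNReal.ofReal δ + ENNReal.ofReal (J / 4 / Fintype.card ι) :=
          add_le_add (not_le.1 hE).le hj
      _ = ENNReal.ofReal (δ + 1 / 4) := by
          rw [← hJ, ← ENNReal.ofReal_add hδ.le (by positivity)]
          congr 2
          field_simp
      _ ≤ _ := ENNReal.ofReal_le_ofReal (by linarith)
  · refine le_quarter_div_pow (u := 20 * Δ ^ 2) hQ1' hx0 (by norm_num) hx1 hc hc0 hδ hδ1
      (by nlinarith only [sq_nonneg Δ]) le_rfl ?_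
    rw [← hN]
    have hm1 : (m : ℝ) ≤ 4 * N / (e * J) := by
      rw [hm]; exact Nat.floor_le (by positivity)
    have h2 : 4 * N / (e * J) ≤ 288000 * (1 - γ) * N / Q := by
      rw [div_le_div_iff₀ (by positivity) (by linarith)]
      have h3 : 1 * Q ≤ 2000 * ((1 - γ) * e) * (36 * J) :=
        mul_le_mul heγ hJQ (by linarith) (by linarith)
      nlinarith only [mul_le_mul_of_nonneg_left h3 hNR.le]
    calc m * (20 * Δ ^ 2) ≤ 288000 * (1 - γ) * N / Q * (20 * Δ ^ 2) :=
          mul_le_mul_of_nonneg_right (hm1.trans h2) (by positivity)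
      -- 288000 · 20 · 9000², where 288000 = 4 · 2000 · 36; the 5 · 10^14 of the hypotheses rounds
      -- it up.
      _ = 466560000000000 * x * N / Q := by rw [hΔ, hx]; ring
      _ ≤ _ := by
          gcongr
          norm_num
  · filter_upwards [C.ae_legal h₁ hn1 π] with ω hω hωB
    have h1 : listCount (pair j) (pastStates ω T) ≤ m := hωB
    rw [hpair, hT] at h1
    have h2 := (card_pulled_le_listCount s₀ b π ω (X := m + N) (C.clk_lt s₀)).trans h1
    have h3 := Finset.card_filter_add_card_filter_not (s := Finset.range (m + N))
      (fun y => ω (C.clk s₀ + y * (n * ℓ)) = s₀ ∧ π (pastStates ω (C.clk s₀ + y * (n * ℓ) + 1)) = b)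
    rw [Finset.card_range] at h3
    have hnl : 0 < n * ℓ := Nat.mul_pos hn (by omega)
    refine MDP.le_encard_errorTimes (((Finset.range (m + N)).filter fun y =>
      ¬ (ω (C.clk s₀ + y * (n * ℓ)) = s₀ ∧ π (pastStates ω (C.clk s₀ + y * (n * ℓ) + 1)) = b)).image
        fun y => C.clk s₀ - C.clk s₀ % ℓ + y * (n * ℓ)) ?_ fun t ht => ?_
    · rw [Finset.card_image_of_injective _ fun y z hyz => by
        simp only [Nat.add_left_cancel_iff] at hyz
        exact Nat.eq_of_mul_eq_mul_right hnl hyz]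
      omega
    · obtain ⟨y, hy, rfl⟩ := Finset.mem_image.1 ht
      exact hω.mem_errorTimes_of_not_pull (by linarith) h₁ hr1 hd1 hℓe hγ0 hγ1 hΔ0.le hthr harm hba
        (Finset.mem_filter.1 hy).2

end ClockSystem

/-! ### Choice of the scale and conclusion -/

/-- `e` is the integer part of 1/(1000(1-γ)), or 1 if this vanishes. In the first case Bernoulli's
inequality bounds the power from below; in the second γ > 3/4 and (3/4)^4 = 81/256 are just enough.
-/
lemma exists_group_length {γ : ℝ} (hγ0 : 3 / 4 < γ) (hγ1 : γ < 1) :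
    ∃ e : ℕ, 1 ≤ e ∧ 1 ≤ 2000 * ((1 - γ) * e) ∧ 1 / 4 ≤ γ ^ (3 * e + 1)
      ∧ (e = 1 ∨ 1000 * ((1 - γ) * e) ≤ 1) := by
  have hη : 0 < 1 - γ := by linarith
  have hy0 : (0 : ℝ) ≤ 1 / (1000 * (1 - γ)) := by positivity
  have hlt := Nat.lt_floor_add_one (1 / (1000 * (1 - γ)))
  have hle := Nat.floor_le hy0
  rw [div_lt_iff₀ (by positivity)] at hlt
  rw [le_div_iff₀ (by positivity)] at hle
  rcases Nat.eq_zero_or_pos ⌊1 / (1000 * (1 - γ))⌋₊ with h0 | hpos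
  · rw [h0, Nat.cast_zero, zero_add] at hlt
    refine ⟨1, le_rfl, by push_cast; linarith, ?_, Or.inl rfl⟩
    calc (1 : ℝ) / 4 ≤ (3 / 4) ^ (3 * 1 + 1) := by norm_num
      _ ≤ _ := pow_le_pow_left₀ (by norm_num) hγ0.le _
  · generalize ⌊1 / (1000 * (1 - γ))⌋₊ = e at hlt hle hpos
    have he : (1 : ℝ) ≤ e := by exact_mod_cast hpos
    refine ⟨e, hpos, by nlinarith, ?_, Or.inr (by linarith)⟩
    have h := one_add_mul_le_pow (a := γ - 1) (by linarith) (3 * e + 1)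
    rw [add_sub_cancel] at h
    push_cast at h
    nlinarith

theorem theorem3 :
    ∃ c₁ c₂ ε₀ : ℝ, 0 < c₁ ∧ 0 < c₂ ∧ 0 < ε₀ ∧
      ∀ (S A : Type*) [Fintype S] [Fintype A] [MeasurableSpace S] [DiscreteMeasurableSpace S]
        (γ ε δ : ℝ),
        4 ≤ Fintype.card S → 2 ≤ Fintype.card A →
        3 / 4 < γ → γ < 1 → 0 < ε → ε < ε₀ / (1 - γ) → 0 < δ → δ < 1 →
        ∃ (r : S → ℝ) (s₁ : S) (sp sm : S → A → S),
          ∀ π : Policy S A, ∃ M : MDP S A,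
            M.reward = r ∧ M.discount = γ ∧ M.HasNextStates sp sm ∧
            ENNReal.ofReal δ ≤ M.law π s₁
              {ω | ((⌈c₁ * Fintype.card (S × A) / (ε ^ 2 * (1 - γ) ^ 3) *
                  Real.log (c₂ / δ)⌉₊ : ℕ) : ℕ∞) ≤ (M.errorTimes π ε ω).encard} := by
  refine ⟨1 / (5 * 10 ^ 14), 1 / 12, 1 / 10 ^ 8, by norm_num, by norm_num, by norm_num, ?_⟩
  intro S A _ _ _ _ γ ε δ hS hA hγ0 hγ1 hε hεγ hδ hδ1
  have hη : 0 < 1 - γ := by linarith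
  have hγp : 0 < γ := by linarith
  rw [lt_div_iff₀ hη] at hεγ
  rcases lt_or_ge δ (1 / 12) with hδ12 | hδ12
  · have hx : 5 * 10 ^ 14 * (ε ^ 2 * (1 - γ) ^ 3) ≤ 1 := by
      calc 5 * 10 ^ 14 * (ε ^ 2 * (1 - γ) ^ 3) = 5 * 10 ^ 14 * ((ε * (1 - γ)) ^ 2 * (1 - γ)) := by
            ring
        _ ≤ 5 * 10 ^ 14 * ((1 / 10 ^ 8) ^ 2 * 1) := by
            gcongr
            linarith
        _ ≤ 1 := by norm_num
    obtain ⟨e, he, heγ, hpow, he1⟩ := exists_group_length hγ0 hγ1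
    -- 9e - 5 = 3ℓ - 2 is the size of one group with ℓ = 3e - 1. If S cannot hold a group, then e >
    -- 1 because |S| ≥ 4, and |S|(1-γ) is small enough for navigation.
    rcases Nat.lt_or_ge (Fintype.card S) (9 * e - 5) with hcard | hcard
    · have heη : 1000 * ((1 - γ) * e) ≤ 1 := he1.resolve_left (by omega)
      have hcard' : (3 * Fintype.card S + 2 : ℝ) ≤ 27 * e := by
        have : 3 * Fintype.card S + 2 ≤ 27 * e := by omega
        exact_mod_cast this
      refine MDP.exists_hard_navigation hS hA hγ0 hγ1 hε ?_ ?_ hδ hδ12 (by norm_num) (by norm_num) ?_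
      · linarith
      · nlinarith
      · nlinarith
    · have hn : 1 ≤ Fintype.card S / (9 * e - 5) := (Nat.one_le_div_iff (by omega)).2 hcard
      obtain ⟨C⟩ := nonempty_clockSystem S (ℓ := 3 * e - 1) (n := Fintype.card S / (9 * e - 5))
        (by omega) hn (by
          have : 3 * (3 * e - 1) - 2 = 9 * e - 5 := by omega
          rw [this]
          exact Nat.div_mul_le_self _ _)
      refine C.exists_hard_ring (by omega) hn hA ?_ ?_ hγp hγ1 hε ?_ heγ hpow hδ hδ12 (by norm_num)
        (by norm_num) hx
      · rw [Fintype.card_prod]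
        generalize hk : Fintype.card S / (9 * e - 5) = k at hn
        have h1 : Fintype.card S < (9 * e - 5) * (k + 1) := by
          rw [← hk]; exact Nat.lt_mul_div_succ _ (by omega)
        -- Rounding to whole groups costs at most a factor 2, since k + 1 ≤ 2k; the other factor 2
        -- in 36 is |A| ≤ 2(|A| - 1).
        have h2 : Fintype.card S ≤ 18 * (k * e) := by
          have h3 : (9 * e - 5) * (k + 1) ≤ 9 * e * (k + k) := Nat.mul_le_mul (by omega) (by omega)
          calc _ ≤ 9 * e * (k + k) := h1.le.trans h3
            _ = _ := by ring
        calc _ ≤ 18 * (k * e) * (2 * (Fintype.card A - 1)) := Nat.mul_le_mul h2 (by omega)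
          _ = _ := by ring
      · rw [Fintype.card_prod]
        nlinarith
      · linarith
  -- For δ ≥ 1/12 the logarithm is nonpositive and N = 0, so any MDP will do.
  · have hSne : Nonempty S := Fintype.card_pos_iff.1 (by omega)
    let s₁ : S := Classical.arbitrary S
    refine ⟨fun _ => 0, s₁, fun _ _ => s₁, fun _ _ => s₁, fun π => ?_⟩
    obtain ⟨M, hr, hd, hn, -⟩ := MDP.exists_isTwoPoint (fun _ _ => s₁) (fun _ _ => s₁)
      (fun (_ : S) (_ : A) => (0 : ℝ)) (fun _ _ => by simp) (fun _ => 0) (fun _ => by simp) γ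
      ⟨hγp, hγ1⟩
    refine ⟨M, hr, hd, hn, ?_⟩
    have hlog : Real.log (1 / 12 / δ) ≤ 0 :=
      Real.log_nonpos (by positivity) ((div_le_one hδ).2 hδ12)
    have hceil : ⌈1 / (5 * 10 ^ 14) * (Fintype.card (S × A) : ℝ) / (ε ^ 2 * (1 - γ) ^ 3)
        * Real.log (1 / 12 / δ)⌉₊ = 0 :=
      Nat.ceil_eq_zero.2 (mul_nonpos_of_nonneg_of_nonpos (by positivity) hlog)
    rw [hceil]
    simp only [Nat.cast_zero, zero_le, Set.ofPred_true, measure_univ]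
    exact ENNReal.ofReal_le_one.2 hδ1.le
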